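/- Let $N=3$ and let $\eta=(\eta_{\alpha\beta})$ be any real symmetric nondegenerate $3\times 3$ matrix, with inverse $(\eta^{\alpha\beta})$. For a function $F(t^1,t^2,t^3)$ with $F_{1\alpha\beta}=\eta_{\alpha\beta}$ (subscripts denote third partial derivatives; $F$ is of class $C^4$ on an open set) the WDVV system is $$S_{\alpha\beta\gamma\nu}:=\eta^{\lambda\mu}(F_{\lambda\alpha\beta}F_{\mu\gamma\nu}-F_{\lambda\alpha\nu}F_{\mu\gamma\beta})=0,\qquad \alpha,\beta,\gamma,\nu=1,2,3.$$ Let $\psi^1_{kh}=\psi^2_{kh}=0$, let $\psi^3_{kh}$ be skew-symmetric with $\psi^3_{12}=-\eta^{22}$, $\psi^3_{13}=-\eta^{23}$, $\psi^3_{23}=-\eta^{33}$, and let $$\Omega=\begin{pmatrix}1&0&0\\0&1&0\\-\eta^{12}\eta_{23}&\eta^{12}\eta_{22}-\eta^{13}\eta_{23}&\eta^{13}\eta_{22}\end{pmatrix},\quad \Theta=\begin{pmatrix}0&1&0\\0&0&1\\-\eta^{12}\eta_{33}&\eta^{12}\eta_{23}-\eta^{13}\eta_{33}&\eta^{13}\eta_{23}\end{pmatrix},$$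 $$\xi=\begin{pmatrix}0\\0\\-\eta^{11}(\eta_{22}\eta_{33}-\eta_{23}^2)\end{pmatrix},\quad \phi=\begin{pmatrix} \eta^{11}\eta^{22}-(\eta^{12})^2&\eta^{11}\eta^{23}-\eta^{12}\eta^{13}&\eta^{12}\eta^{23}-\eta^{13}\eta^{22}\\ \eta^{11}\eta^{23}-\eta^{12}\eta^{13}&\eta^{11}\eta^{33}-(\eta^{13})^2&\eta^{12}\eta^{33}-\eta^{13}\eta^{23}\\ \eta^{12}\eta^{23}-\eta^{13}\eta^{22}&\eta^{12}\eta^{33}-\eta^{13}\eta^{23}&\eta^{22}\eta^{33}-(\eta^{23})^2\end{pmatrix}.$$ Choose $p\in\{2,3\}$ and let $q$ be the other element of $\{2,3\}$. Put $u=(F_{p22},F_{p23},F_{p33})$ and $v=(F_{q22},F_{q23},F_{q33})$; put $(\omega,\theta,\zeta)=(\Omega,\Theta,\xi)$ if $p=2$ and $(\omega,\theta,\zeta)=(\Theta,\Omega,-\xi)$ if $p=3$. Consider the linear line congruence $$\tfrac12\psi^\gamma_{km}(u^mv^k-u^kv^m)+\omega^\gamma_kv^k-\theta^\gamma_mu^m-\zeta^\gamma=0,\qquad\gamma=1,2,3,\qquad(*)$$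 and let $\psi^\gamma_i(u)=\psi^\gamma_{ik}u^k+\omega^\gamma_i$ and $U=\{u\in\mathbb R^3:\det(\psi^\gamma_i(u))\ne0\}$. Then: 1. $\phi$ is nondegenerate, and $(\psi^\gamma_i)$ is (generically) nondegenerate: $U$ is open and dense in $\mathbb R^3$. 2. For $F$ as above, the WDVV system is equivalent to $(*)$. For $u\in U$ and $v\in\mathbb R^3$, $(*)$ is equivalent to $v=V(u)$, where $V^i=\psi^i_\gamma Z^\gamma$, $(\psi^i_\gamma)=(\psi^\gamma_i)^{-1}$, $Z^\gamma=\theta^\gamma_ku^k+\zeta^\gamma$. Thus the WDVV system is rewritten as the system of conservation laws $$\partial_{t^q}u^I=\partial_{t^p}\big(V^I(u)\big),\qquad I=1,2,3:\qquad(**)$$ if $F$ as above solves the WDVV system, then $u=(F_{p22},F_{p23},F_{p33})$ satisfies $(**)$ at all points where $u\in U$; conversely, on a convex open set every $C^1$ solution $u$ of $(**)$ with values in $U$ and independent of $t^1$ is $(F_{p22},F_{p23},F_{p33})$ for some $F$ as above that solves the WDVV system. 3. Let $f_{ij}=\phi_{\alpha\beta}\psi^\alpha_i\psi^\beta_j$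 (a symmetric matrix that is nondegenerate on $U$), let $(f^{ij})$ be its inverse, $c_{skm}=\frac13(f_{sm,k}-f_{sk,m})$, and define $c^{ij}_k$ by $c_{ijk}=f_{iq}f_{jp}c^{pq}_k$. With $x=t^p$, the third-order operator $A^{ij}=D_x\circ(f^{ij}D_x+c^{ij}_ku^k_x)\circ D_x$ is Hamiltonian for fields $u$ with values in $U$: the bracket $\{P,Q\}=\int\frac{\delta P}{\delta u^i}A^{ij}\frac{\delta Q}{\delta u^j}\,dx$ of local functionals (densities are smooth functions of $x$ and finitely many $x$-derivatives of $u$, taken modulo total $x$-derivatives) is skew-symmetric and satisfies the Jacobi identity. 4. The system $(**)$ is Hamiltonian with respect to $A$, that is, with $t=t^q$, $u^i_t=A^{ij}\frac{\delta H}{\delta u^j}$ for a functional $H=\int h\,dx$ whose density $h$ is a smooth function of $x$, of the potentials $b^j$ with $b^j_x=u^j$, and of finitely many of their $x$-derivatives. Here $D_x\frac{\delta H}{\delta u^j}=-\frac{\delta H}{\delta b^j}$, so this means $D_x\big(V^i(b_x)\big)=-D_x\big((f^{ij}(b_x)D_x+c^{ij}_k(b_x)b^k_{xx})\frac{\delta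 H}{\delta b^j}\big)$. -/

import Mathlib

open scoped Matrix

noncomputable section

namespace WDVV

/-! ### Differential functions, total derivative, variational derivatives -/

/-- Points `(x, (u^i_k)_{k, i})` of the infinite jet space of curves `x ↦ u(x) ∈ ℝⁿ`;
`q.2 k i` is the coordinate `u^i_k = ∂_x^k u^i`. -/
abbrev Jet (n : ℕ) : Type := ℝ × (ℕ → Fin n → ℝ)

variable {n : ℕ}

/-- The jet of order less than `k`. -/
def jetTrunc (k : ℕ) (q : Jet n) : ℝ × (Fin k → Fin n → ℝ) := (q.1, fun j => q.2 j)

/-- `P` is a differential function on `Ω`: a smooth function of `x` and of finitely many of the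
jet coordinates. -/
def IsDiffFun (Ω : Set (Jet n)) (P : Jet n → ℝ) : Prop :=
  ∃ (k : ℕ) (p : ℝ × (Fin k → Fin n → ℝ) → ℝ),
    ContDiffOn ℝ (⊤ : ℕ∞) p (jetTrunc k '' Ω) ∧ ∀ q ∈ Ω, P q = p (jetTrunc k q)

/-- The partial derivative `∂P/∂x`. -/
def partialX (P : Jet n → ℝ) : Jet n → ℝ := fun q => deriv (fun s => P (s, q.2)) q.1

/-- The partial derivative `∂P/∂u^i_k`. -/
def partialU (k : ℕ) (i : Fin n) (P : Jet n → ℝ) : Jet n → ℝ := fun q =>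
  deriv (fun s => P (q.1, Function.update q.2 k (Function.update (q.2 k) i s))) (q.2 k i)

/-- The total derivative `D_x P = ∂P/∂x + ∑ u^i_{k+1} ∂P/∂u^i_k` (a finite sum for differential
functions). -/
def totalD (P : Jet n → ℝ) : Jet n → ℝ := fun q =>
  partialX P q + ∑ᶠ k : ℕ, ∑ i : Fin n, q.2 (k + 1) i * partialU k i P q

/-- The variational derivative `δ/δu^i ∫ P dx = ∑ (-D_x)^k ∂P/∂u^i_k` (a finite sum for
differential functions). -/
def varD (i : Fin n) (P : Jet n → ℝ) : Jet n → ℝ := fun q =>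
  ∑ᶠ k : ℕ, (-1 : ℝ) ^ k * (totalD^[k] (partialU k i P)) q

/-- `∫ P dx = 0` as a local functional on `Ω`: the density `P` is a total derivative. -/
def IsTotalDerivative (Ω : Set (Jet n)) (P : Jet n → ℝ) : Prop :=
  ∃ T : Jet n → ℝ, IsDiffFun Ω T ∧ ∀ q ∈ Ω, P q = totalD T q

/-! ### Hamiltonian operators -/

/-- A density of the bracket `{∫P, ∫Q}_A = ∫ (δP/δu^i) A^{ij} (δQ/δu^j) dx`. -/
def bracket (A : (Fin n → Jet n → ℝ) → Fin n → Jet n → ℝ) (P Q : Jet n → ℝ) : Jet n → ℝ :=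
  fun q => ∑ i, varD i P q * A (fun j => varD j Q) i q

/-- `A` is Hamiltonian on `Ω`: its bracket is a Poisson bracket on local functionals, that is, it is
skew-symmetric and satisfies the Jacobi identity modulo total derivatives. -/
def IsHamiltonianOp (Ω : Set (Jet n)) (A : (Fin n → Jet n → ℝ) → Fin n → Jet n → ℝ) : Prop :=
  (∀ P Q, IsDiffFun Ω P → IsDiffFun Ω Q →
    IsTotalDerivative Ω (fun q => bracket A P Q q + bracket A Q P q)) ∧
  (∀ P Q R, IsDiffFun Ω P → IsDiffFun Ω Q → IsDiffFun Ω R →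
    IsTotalDerivative Ω (fun q => bracket A (bracket A P Q) R q +
      bracket A (bracket A Q R) P q + bracket A (bracket A R P) Q q))

/-! ### Third-order operators `D_x ∘ (f^{ij} D_x + c^{ij}_k u^k_x) ∘ D_x` in canonical form -/

/-- `c_{skm} = (f_{sm,k} - f_{sk,m}) / 3`, where `f_{ij}` is the (lower-index) metric `f`. -/
def lowerC (f : (Fin n → ℝ) → Matrix (Fin n) (Fin n) ℝ) (u : Fin n → ℝ) (s k m : Fin n) : ℝ :=
  (fderiv ℝ (fun w => f w s m) u (Pi.single k 1) -
    fderiv ℝ (fun w => f w s k) u (Pi.single m 1)) / 3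

/-- `c^{pq}_k`, determined by `c_{ijk} = f_{iq} f_{jp} c^{pq}_k`. -/
def upperC (f : (Fin n → ℝ) → Matrix (Fin n) (Fin n) ℝ) (u : Fin n → ℝ) (p q k : Fin n) : ℝ :=
  ∑ i, ∑ j, (f u)⁻¹ q i * (f u)⁻¹ p j * lowerC f u i j k

/-- The inner first-order operator `π ↦ f^{ij}(u) D_x π_j + c^{ij}_k(u) u^k_x π_j`, where `u = u(q)`
and `u_x = u₁(q)` are given as functions on the jet space on which `D_x` acts. -/
def innerOp (f : (Fin n → ℝ) → Matrix (Fin n) (Fin n) ℝ) (u u₁ : Jet n → Fin n → ℝ)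
    (π : Fin n → Jet n → ℝ) (i : Fin n) : Jet n → ℝ := fun q =>
  ∑ j, ((f (u q))⁻¹ i j * totalD (π j) q + (∑ k, upperC f (u q) i j k * u₁ q k) * π j q)

/-- The third-order operator `D_x ∘ (f^{ij} D_x + c^{ij}_k u^k_x) ∘ D_x` defined by `f`. -/
def thirdOrderOp (f : (Fin n → ℝ) → Matrix (Fin n) (Fin n) ℝ)
    (π : Fin n → Jet n → ℝ) (i : Fin n) : Jet n → ℝ :=
  totalD (innerOp f (fun q => q.2 0) (fun q => q.2 1) (fun j => totalD (π j)) i)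

/-- The operator defined by `f` is a (nondegenerate) third-order Hamiltonian operator for fields
`u` with values in `U`. -/
def IsThirdOrderHamiltonian (U : Set (Fin n → ℝ))
    (f : (Fin n → ℝ) → Matrix (Fin n) (Fin n) ℝ) : Prop :=
  (∀ u ∈ U, (f u).IsSymm ∧ (f u).det ≠ 0) ∧
  IsHamiltonianOp {q : Jet n | q.2 0 ∈ U} (thirdOrderOp f)

/-- The system `u^i_t = (V^i(u))_x` has the form `u^i_t = A^{ij} δH/δu^j` for the third-order
operator `A` defined by `f`.  The functional `H` is local in the potentials `b`, `b_x = u`; since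
`δ/δb = -D_x ∘ δ/δu`, one has `D_x (δH/δu^j) = -δH/δb^j`, so that
`A^{ij} δH/δu^j = D_x ((f^{ij} D_x + c^{ij}_k u^k_x) (-δH/δb^j))`.  Points of the jet space are here
jets of `b`, so that `u = q.2 1` and `u_x = q.2 2`. -/
def IsHamiltonianSystem (U : Set (Fin n → ℝ)) (f : (Fin n → ℝ) → Matrix (Fin n) (Fin n) ℝ)
    (V : (Fin n → ℝ) → Fin n → ℝ) : Prop :=
  ∃ h : Jet n → ℝ, IsDiffFun {q : Jet n | q.2 1 ∈ U} h ∧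
    ∀ q : Jet n, q.2 1 ∈ U → ∀ i,
      totalD (fun r => V (r.2 1) i) q =
        totalD (innerOp f (fun r => r.2 1) (fun r => r.2 2) (fun j r => -varD j h r) i) q

/-! ### Linear line congruences -/

/-- The coefficients of a system of `n` linear equations in the Plücker coordinates
`u^m v^k - u^k v^m`, `v^k`, `u^m`, `1` of the lines through `(u, 1, 0)` and `(v, 0, 1)`. -/
structure LineCongruence (n : ℕ) where
  psi : Fin n → Matrix (Fin n) (Fin n) ℝ
  omega : Matrix (Fin n) (Fin n) ℝ
  theta : Matrix (Fin n) (Fin n) ℝ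
  xi : Fin n → ℝ

namespace LineCongruence

/-- The equations
`½ ψ^γ_{km} (u^m v^k - u^k v^m) + ω^γ_k v^k - θ^γ_m u^m - ξ^γ = 0`, for all `γ`. -/
def Holds (C : LineCongruence n) (u v : Fin n → ℝ) : Prop :=
  ∀ γ, 1 / 2 * ∑ k, ∑ m, C.psi γ k m * (u m * v k - u k * v m) + ∑ k, C.omega γ k * v k
    - ∑ m, C.theta γ m * u m - C.xi γ = 0

/-- The matrix `ψ^γ_i(u) = ψ^γ_{ik} u^k + ω^γ_i`. -/
def psiMat (C : LineCongruence n) (u : Fin n → ℝ) : Matrix (Fin n) (Fin n) ℝ :=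
  Matrix.of fun γ i => ∑ k, C.psi γ i k * u k + C.omega γ i

/-- The set of `u` at which `(ψ^γ_i(u))` is invertible. -/
def regular (C : LineCongruence n) : Set (Fin n → ℝ) := {u | (C.psiMat u).det ≠ 0}

/-- The fluxes `V^i = ψ^i_γ Z^γ`, where `(ψ^i_γ)` is the inverse of `(ψ^γ_i)` and
`Z^γ = θ^γ_k u^k + ξ^γ`. -/
def flux (C : LineCongruence n) (u : Fin n → ℝ) : Fin n → ℝ :=
  (C.psiMat u)⁻¹ *ᵥ (C.theta *ᵥ u + C.xi)

/-- The same equations (up to an overall sign) with the roles of `u` and `v` exchanged. -/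
def swap (C : LineCongruence n) : LineCongruence n where
  psi := C.psi
  omega := C.theta
  theta := C.omega
  xi := -C.xi

/-- The Monge metric `f_{ij} = φ_{αβ} ψ^α_i ψ^β_j`. -/
def monge (C : LineCongruence n) (φ : Matrix (Fin n) (Fin n) ℝ) (u : Fin n → ℝ) :
    Matrix (Fin n) (Fin n) ℝ :=
  (C.psiMat u)ᵀ * φ * C.psiMat u

end LineCongruence

/-! ### The WDVV equations for `N = 3`

The coordinates `t¹, t², t³` are indexed by `0, 1, 2 : Fin 3`; `η a b` is `η_{a+1,b+1}` and
`η⁻¹ a b` is `η^{a+1,b+1}`. -/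

/-- The partial derivative of `G` with respect to the coordinate with index `a`. -/
def pderiv (a : Fin 3) (G : (Fin 3 → ℝ) → ℝ) (t : Fin 3 → ℝ) : ℝ := fderiv ℝ G t (Pi.single a 1)

/-- The third derivative `F_{abc}`. -/
def third (F : (Fin 3 → ℝ) → ℝ) (a b c : Fin 3) (t : Fin 3 → ℝ) : ℝ :=
  pderiv a (pderiv b (pderiv c F)) t

/-- `S_{αβγν} = η^{λμ} (F_{λαβ} F_{μγν} - F_{λαν} F_{μγβ})`. -/
def wdvvS (η : Matrix (Fin 3) (Fin 3) ℝ) (F : (Fin 3 → ℝ) → ℝ) (α β γ ν : Fin 3)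
    (t : Fin 3 → ℝ) : ℝ :=
  ∑ l, ∑ m, η⁻¹ l m * (third F l α β t * third F m γ ν t - third F l α ν t * third F m γ β t)

/-- `F` is of class `C⁴` on `W` and `F_{1αβ} = η_{αβ}`. -/
def IsNormalized (η : Matrix (Fin 3) (Fin 3) ℝ) (W : Set (Fin 3 → ℝ)) (F : (Fin 3 → ℝ) → ℝ) :
    Prop :=
  ContDiffOn ℝ 4 F W ∧ ∀ t ∈ W, ∀ α β, third F 0 α β t = η α β

/-- The WDVV system on `W`. -/
def SolvesWDVV (η : Matrix (Fin 3) (Fin 3) ℝ) (W : Set (Fin 3 → ℝ)) (F : (Fin 3 → ℝ) → ℝ) :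
    Prop :=
  ∀ t ∈ W, ∀ α β γ ν, wdvvS η F α β γ ν t = 0

/-- The field variables `(F_{p22}, F_{p23}, F_{p33})`. -/
def fields (F : (Fin 3 → ℝ) → ℝ) (p : Fin 3) (t : Fin 3 → ℝ) : Fin 3 → ℝ :=
  ![third F p 1 1 t, third F p 1 2 t, third F p 2 2 t]

/-- The system of conservation laws `∂_q u^I = ∂_p (V^I(u))` at the point `t`. -/
def ConservationLawAt (p q : Fin 3) (V : (Fin 3 → ℝ) → Fin 3 → ℝ)
    (u : (Fin 3 → ℝ) → Fin 3 → ℝ) (t : Fin 3 → ℝ) : Prop :=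
  ∀ I, pderiv q (fun s => u s I) t = pderiv p (fun s => V (u s) I) t

/-- The linear line congruence of the WDVV equations (in the order `S_{1223}`, `S_{1233}`,
`S_{2233}`), where `u = (F_{222}, F_{223}, F_{233})` and `v = (F_{322}, F_{323}, F_{333})`. -/
def wdvvCongruence (η : Matrix (Fin 3) (Fin 3) ℝ) : LineCongruence 3 where
  psi := ![0, 0,
    !![0, -η⁻¹ 1 1, -η⁻¹ 1 2;
       η⁻¹ 1 1, 0, -η⁻¹ 2 2;
       η⁻¹ 1 2, η⁻¹ 2 2, 0]]
  omega :=
    !![1, 0, 0;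
       0, 1, 0;
       -(η⁻¹ 0 1 * η 1 2), η⁻¹ 0 1 * η 1 1 - η⁻¹ 0 2 * η 1 2, η⁻¹ 0 2 * η 1 1]
  theta :=
    !![0, 1, 0;
       0, 0, 1;
       -(η⁻¹ 0 1 * η 2 2), η⁻¹ 0 1 * η 1 2 - η⁻¹ 0 2 * η 2 2, η⁻¹ 0 2 * η 1 2]
  xi := ![0, 0, -(η⁻¹ 0 0 * (η 1 1 * η 2 2 - η 1 2 ^ 2))]

/-- The congruence for the choice of the independent variable with index `p`: the one above for
`t²`, and the one with `u` and `v` exchanged for `t³`. -/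
def chosenCongruence (η : Matrix (Fin 3) (Fin 3) ℝ) (p : Fin 3) : LineCongruence 3 :=
  if p = 1 then wdvvCongruence η else (wdvvCongruence η).swap

/-- The matrix `φ`. -/
def phi (η : Matrix (Fin 3) (Fin 3) ℝ) : Matrix (Fin 3) (Fin 3) ℝ :=
  !![η⁻¹ 0 0 * η⁻¹ 1 1 - η⁻¹ 0 1 ^ 2,
      η⁻¹ 0 0 * η⁻¹ 1 2 - η⁻¹ 0 1 * η⁻¹ 0 2,
      η⁻¹ 0 1 * η⁻¹ 1 2 - η⁻¹ 0 2 * η⁻¹ 1 1;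
     η⁻¹ 0 0 * η⁻¹ 1 2 - η⁻¹ 0 1 * η⁻¹ 0 2,
      η⁻¹ 0 0 * η⁻¹ 2 2 - η⁻¹ 0 2 ^ 2,
      η⁻¹ 0 1 * η⁻¹ 2 2 - η⁻¹ 0 2 * η⁻¹ 1 2;
     η⁻¹ 0 1 * η⁻¹ 1 2 - η⁻¹ 0 2 * η⁻¹ 1 1,
      η⁻¹ 0 1 * η⁻¹ 2 2 - η⁻¹ 0 2 * η⁻¹ 1 2,
      η⁻¹ 1 1 * η⁻¹ 2 2 - η⁻¹ 1 2 ^ 2]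

end WDVV

end

/-!
Write `M = (ψ^γ_i(u))`, which is affine in `u`, and `K = φ⁻¹`. The third-order operator factors as
`D M⁻¹ K D M⁻ᵀ D`, so its skew-symmetry is integration by parts. In the Jacobi identity the terms
with derivatives of the two variational derivatives cancel because the linearization of a
variational derivative is formally self-adjoint; what is left is a cyclic sum of terms
`⟨φ M x, ψ(z) y⟩`, whose vanishing is the Monge condition on the congruence. For `n = 3` and the
WDVV congruence that cyclic sum is an alternating 3-form, so a single coefficient has to vanish.

As `Mᵀ` cancels `M⁻ᵀ`, the operator `D M⁻¹ K D M⁻ᵀ` sends the covector `Mᵀ φ (θ b + x ξ)`, where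
`b_x = u`, to the `x`-derivative of the flux `M⁻¹ (θ u + ξ)`. Up to sign this covector is the
variational derivative with respect to `b` of a density polynomial in `b`, `u` and `x`.

The WDVV equations say that the matrices `(η^{λμ} F_{μαβ})` of multiplication by the coordinate
fields commute. The first field is the unit, so one commutator remains; with an index lowered it is
a skew `3 × 3` matrix whose row at the unit vanishes, hence a single scalar equation. The other two
rows of the congruence express the symmetry of the third derivatives of `F`. Conversely `F` is
recovered from a solution of the conservation laws by applying the Poincaré lemma three times on the
convex domain.
-/

noncomputable section

namespace WDVV

section MatrixDerivation

variable {𝕜 ι R : Type*} [CommRing 𝕜] [CommRing R] [Algebra 𝕜 R]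
  (δ : Derivation 𝕜 R R)

lemma derivation_map_algebraMap {κ : Type*} (K : Matrix κ ι 𝕜) :
    (K.map (algebraMap 𝕜 R)).map δ = 0 := by
  ext i j
  simp

variable [Fintype ι]

lemma derivation_dotProduct (v w : ι → R) : δ (v ⬝ᵥ w) = (δ ∘ v) ⬝ᵥ w + v ⬝ᵥ (δ ∘ w) := by
  simp only [dotProduct, map_sum, Derivation.leibniz, smul_eq_mul, Function.comp_apply,
    ← Finset.sum_add_distrib]
  exact Finset.sum_congr rfl fun i _ => by ring

lemma derivation_mulVec {κ : Type*} (M : Matrix κ ι R) (v : ι → R) :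
    δ ∘ (M *ᵥ v) = M.map δ *ᵥ v + M *ᵥ (δ ∘ v) :=
  funext fun i => derivation_dotProduct δ (M i) v

lemma derivation_const_mulVec {κ : Type*} (K : Matrix κ ι 𝕜) (v : ι → R) :
    δ ∘ (K.map (algebraMap 𝕜 R) *ᵥ v) = K.map (algebraMap 𝕜 R) *ᵥ (δ ∘ v) := by
  rw [derivation_mulVec, derivation_map_algebraMap, Matrix.zero_mulVec, zero_add]

lemma derivation_mul {κ μ : Type*} (M : Matrix κ ι R) (N : Matrix ι μ R) :
    (M * N).map δ = M.map δ * N + M * N.map δ := by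
  ext i j
  exact derivation_dotProduct δ (M i) (N.col j)

lemma derivation_inv [DecidableEq ι] {M : Matrix ι ι R} (hM : IsUnit M.det) :
    M⁻¹.map δ = -(M⁻¹ * M.map δ * M⁻¹) := by
  have h : M.map δ * M⁻¹ + M * M⁻¹.map δ = 0 := by
    rw [← derivation_mul, Matrix.mul_nonsing_inv _ hM]
    ext i j
    by_cases hij : i = j <;> simp [hij]
  rw [Matrix.mul_assoc, eq_neg_of_add_eq_zero_left h, Matrix.mul_neg, neg_neg,
    Matrix.nonsing_inv_mul_cancel_left _ _ hM]

end MatrixDerivation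

/-- An algebra of differential functions in the fields `u^i`, `i ∈ ι`: `D` is the total derivative
and `d k i` is `∂/∂u^i_k`.  The independent variable and the coordinates `u^i_k` are left out;
only the commutation relations of the derivations and finiteness of the order are recorded. -/
structure JetAlgebra (𝕜 ι R : Type*) [CommRing 𝕜] [CommRing R] [Algebra 𝕜 R] where
  D : Derivation 𝕜 R R
  d : ℕ → ι → Derivation 𝕜 R R
  d_comm : ∀ k i l j P, d k i (d l j P) = d l j (d k i P)
  d_zero_D : ∀ i P, d 0 i (D P) = D (d 0 i P)
  d_succ_D : ∀ k i P, d (k + 1) i (D P) = D (d (k + 1) i P) + d k i P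
  exists_order : ∀ P, ∃ K, ∀ k, K ≤ k → ∀ i, d k i P = 0

namespace JetAlgebra

variable {𝕜 ι R : Type*} [CommRing 𝕜] [CommRing R] [Algebra 𝕜 R] (S : JetAlgebra 𝕜 ι R)

/-- `P` depends on the coordinates `u^i_k` with `k < K` only. -/
def HasOrderLT (K : ℕ) (P : R) : Prop := ∀ k, K ≤ k → ∀ i, S.d k i P = 0

variable {S} {K L : ℕ} {P Q : R}

lemma HasOrderLT.mono (hP : S.HasOrderLT K P) (h : K ≤ L) : S.HasOrderLT L P :=
  fun k hk => hP k (h.trans hk)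

lemma HasOrderLT.add (hP : S.HasOrderLT K P) (hQ : S.HasOrderLT K Q) :
    S.HasOrderLT K (P + Q) :=
  fun k hk i => by rw [map_add, hP k hk, hQ k hk, add_zero]

lemma HasOrderLT.mul (hP : S.HasOrderLT K P) (hQ : S.HasOrderLT K Q) :
    S.HasOrderLT K (P * Q) :=
  fun k hk i => by rw [Derivation.leibniz, hP k hk, hQ k hk, smul_zero, smul_zero, add_zero]

lemma HasOrderLT.smul (c : 𝕜) (hP : S.HasOrderLT K P) : S.HasOrderLT K (c • P) :=
  fun k hk i => by rw [Derivation.map_smul, hP k hk, smul_zero]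

lemma HasOrderLT.d (hP : S.HasOrderLT K P) (l : ℕ) (j : ι) : S.HasOrderLT K (S.d l j P) :=
  fun k hk i => by rw [S.d_comm, hP k hk, map_zero]

lemma HasOrderLT.D (hP : S.HasOrderLT K P) : S.HasOrderLT (K + 1) (S.D P) := by
  rintro (_ | k) hk i
  · omega
  · rw [S.d_succ_D, hP k (by omega), hP (k + 1) (by omega), map_zero, add_zero]

variable (S)

lemma exists_hasOrderLT (P Q : R) : ∃ K, S.HasOrderLT K P ∧ S.HasOrderLT K Q := by
  obtain ⟨K, hK⟩ := S.exists_order P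
  obtain ⟨L, hL⟩ := S.exists_order Q
  exact ⟨max K L, HasOrderLT.mono hK (le_max_left K L), HasOrderLT.mono hL (le_max_right K L)⟩

/-- The variational derivative `δP/δu^i = ∑ (-D)^k ∂P/∂u^i_k`. -/
def varDeriv (P : R) (i : ι) : R := ∑ᶠ k : ℕ, (-1 : R) ^ k * S.D^[k] (S.d k i P)

variable {S} in
lemma varDeriv_eq_sum (hP : S.HasOrderLT K P) (i : ι) :
    S.varDeriv P i = ∑ k ∈ Finset.range K, (-1 : R) ^ k * S.D^[k] (S.d k i P) := by
  refine finsum_eq_sum_of_support_subset _ fun k hk => ?_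
  contrapose! hk
  have hKk : K ≤ k := by simpa using hk
  simp [hP k hKk]

lemma varDeriv_eq_of_hasOrderLT_two (hP : S.HasOrderLT 2 P) (i : ι) :
    S.varDeriv P i = S.d 0 i P - S.D (S.d 1 i P) := by
  rw [S.varDeriv_eq_sum hP, Finset.sum_range_succ, Finset.sum_range_one, pow_zero, one_mul,
    pow_one, neg_one_mul, Function.iterate_zero_apply, Function.iterate_one, ← sub_eq_add_neg]

lemma varDeriv_smul (c : 𝕜) (P : R) : S.varDeriv (c • P) = c • S.varDeriv P := by
  obtain ⟨K, hK⟩ := S.exists_order P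
  funext i
  have hD : ∀ (k : ℕ) (Q : R), S.D^[k] (c • Q) = c • S.D^[k] Q := fun k Q =>
    Function.Commute.iterate_left (f := S.D) (g := fun P => c • P) (S.D.map_smul c) k Q
  rw [Pi.smul_apply, varDeriv_eq_sum (HasOrderLT.smul c hK), varDeriv_eq_sum hK]
  simp only [Derivation.map_smul, hD, Finset.smul_sum, mul_smul_comm]

/-- The functional `∫ P dx`: the class of the density `P` modulo total derivatives. -/
def integral : R →ₗ[𝕜] R ⧸ LinearMap.range (S.D : R →ₗ[𝕜] R) := Submodule.mkQ _

lemma integral_eq_zero_iff : S.integral P = 0 ↔ ∃ T, S.D T = P := by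
  rw [integral, Submodule.mkQ_apply, Submodule.Quotient.mk_eq_zero]
  rfl

lemma integral_D (P : R) : S.integral (S.D P) = 0 := S.integral_eq_zero_iff.2 ⟨P, rfl⟩

lemma integral_mul_D (P Q : R) : S.integral (P * S.D Q) = -S.integral (S.D P * Q) := by
  have h := S.integral_D (P * Q)
  rw [Derivation.leibniz, map_add, smul_eq_mul, smul_eq_mul, mul_comm Q] at h
  exact eq_neg_of_add_eq_zero_left h

lemma integral_iterate_D_mul (k : ℕ) (P Q : R) :
    S.integral (S.D^[k] P * Q) = S.integral (P * ((-1) ^ k * S.D^[k] Q)) := by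
  induction k generalizing Q with
  | zero => simp
  | succ k ih =>
    rw [Function.iterate_succ_apply', ← neg_neg (S.integral (S.D _ * Q)), ← integral_mul_D, ih,
      ← map_neg, Function.iterate_succ_apply S.D k Q]
    congr 1
    ring

variable [Fintype ι]

/-- The function underlying the evolutionary derivation `JetAlgebra.evolve`. -/
def evolveFun (X : ι → R) (P : R) : R := ∑ᶠ k : ℕ, ∑ i, S.D^[k] (X i) * S.d k i P

variable {S} in
lemma evolveFun_eq_sum (X : ι → R) (hP : S.HasOrderLT K P) :
    S.evolveFun X P = ∑ k ∈ Finset.range K, ∑ i, S.D^[k] (X i) * S.d k i P := by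
  refine finsum_eq_sum_of_support_subset _ fun k hk => ?_
  contrapose! hk
  have hKk : K ≤ k := by simpa using hk
  simp [hP k hKk]

/-- The evolutionary derivation `∑ D^k X^i ∂/∂u^i_k` with characteristic `X`. -/
def evolve (X : ι → R) : Derivation 𝕜 R R :=
  Derivation.mk'
    { toFun := S.evolveFun X
      map_add' := fun P Q => by
        obtain ⟨K, hP, hQ⟩ := S.exists_hasOrderLT P Q
        simp only [evolveFun_eq_sum X hP, evolveFun_eq_sum X hQ, evolveFun_eq_sum X (hP.add hQ),
          map_add, mul_add, Finset.sum_add_distrib]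
      map_smul' := fun c P => by
        obtain ⟨K, hP⟩ := S.exists_order P
        simp only [evolveFun_eq_sum X hP, evolveFun_eq_sum X (HasOrderLT.smul c hP),
          Derivation.map_smul, mul_smul_comm, Finset.smul_sum, RingHom.id_apply] }
    fun P Q => by
      obtain ⟨K, hP, hQ⟩ := S.exists_hasOrderLT P Q
      simp only [LinearMap.coe_mk, AddHom.coe_mk, evolveFun_eq_sum X hP, evolveFun_eq_sum X hQ,
        evolveFun_eq_sum X (hP.mul hQ), Derivation.leibniz, smul_eq_mul, Finset.mul_sum,
        ← Finset.sum_add_distrib]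
      exact Finset.sum_congr rfl fun k _ => Finset.sum_congr rfl fun i _ => by ring

variable {S} in
lemma evolve_eq_sum (X : ι → R) (hP : S.HasOrderLT K P) :
    S.evolve X P = ∑ k ∈ Finset.range K, ∑ i, S.D^[k] (X i) * S.d k i P :=
  evolveFun_eq_sum X hP

lemma evolve_D (X : ι → R) (P : R) : S.evolve X (S.D P) = S.D (S.evolve X P) := by
  obtain ⟨K, hK⟩ := S.exists_order P
  have hP : S.HasOrderLT K P := hK
  rw [evolve_eq_sum X hP.D, evolve_eq_sum X (hP.mono K.le_succ), Finset.sum_range_succ']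
  simp only [S.d_succ_D, S.d_zero_D, mul_add, Finset.sum_add_distrib, map_sum, Derivation.leibniz,
    smul_eq_mul, Function.iterate_succ_apply']
  rw [Finset.sum_range_succ' (fun k => ∑ i, S.D^[k] (X i) * S.D (S.d k i P)),
    Finset.sum_range_succ (fun k => ∑ i, S.d k i P * S.D (S.D^[k] (X i)))]
  simp only [hP K le_rfl, zero_mul, Finset.sum_const_zero, add_zero, Function.iterate_succ_apply',
    mul_comm (S.d _ _ P)]
  ring

lemma evolve_iterate_D (X : ι → R) (k : ℕ) (P : R) :
    S.evolve X (S.D^[k] P) = S.D^[k] (S.evolve X P) :=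
  (Function.Semiconj.iterate_right (f := S.evolve X) (S.evolve_D X) k) P

variable {S} in
lemma evolve_evolve (X Y : ι → R) (hP : S.HasOrderLT K P) :
    S.evolve X (S.evolve Y P) = S.evolve (S.evolve X ∘ Y) P +
      ∑ a ∈ Finset.range K ×ˢ Finset.univ, ∑ b ∈ Finset.range K ×ˢ Finset.univ,
        S.D^[a.1] (Y a.2) * (S.D^[b.1] (X b.2) * S.d b.1 b.2 (S.d a.1 a.2 P)) := by
  simp only [evolve_eq_sum Y hP, evolve_eq_sum (S.evolve X ∘ Y) hP, map_sum, Derivation.leibniz,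
    smul_eq_mul, Finset.sum_add_distrib, S.evolve_iterate_D, Function.comp_apply,
    evolve_eq_sum X (hP.d _ _), Finset.mul_sum, Finset.sum_product, mul_comm (S.d _ _ P)]
  exact add_comm _ _

lemma evolve_evolve_sub (X Y : ι → R) (P : R) :
    S.evolve X (S.evolve Y P) - S.evolve Y (S.evolve X P) =
      S.evolve (S.evolve X ∘ Y) P - S.evolve (S.evolve Y ∘ X) P := by
  obtain ⟨K, hP⟩ := S.exists_order P
  rw [evolve_evolve X Y hP, evolve_evolve Y X hP, Finset.sum_comm]
  simp only [S.d_comm _ _ _ _ P, mul_left_comm (S.D^[_] (Y _))]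
  ring

lemma integral_dotProduct_D (v w : ι → R) :
    S.integral (v ⬝ᵥ (S.D ∘ w)) = -S.integral ((S.D ∘ v) ⬝ᵥ w) := by
  simp only [dotProduct, map_sum, Function.comp_apply, integral_mul_D, Finset.sum_neg_distrib]

lemma integral_evolve (X : ι → R) (P : R) :
    S.integral (S.evolve X P) = S.integral (X ⬝ᵥ S.varDeriv P) := by
  obtain ⟨K, hP⟩ := S.exists_order P
  rw [evolve_eq_sum X hP, dotProduct]
  simp only [varDeriv_eq_sum hP, map_sum, S.integral_iterate_D_mul, Finset.mul_sum]
  exact Finset.sum_comm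

lemma integral_evolve_evolve (X Y : ι → R) (P : R) :
    S.integral (S.evolve X (S.evolve Y P)) =
      S.integral ((S.evolve X ∘ S.varDeriv P) ⬝ᵥ Y) +
        S.integral (S.evolve (S.evolve X ∘ Y) P) := by
  obtain ⟨T, hT⟩ := S.integral_eq_zero_iff.1 (show S.integral
    (S.evolve Y P - Y ⬝ᵥ S.varDeriv P) = 0 by rw [map_sub, integral_evolve, sub_self])
  rw [eq_add_of_sub_eq hT.symm, map_add, S.evolve_D, map_add, integral_D, zero_add,
    derivation_dotProduct, map_add, S.integral_evolve, dotProduct_comm Y, add_comm]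

/-- The linearization of the variational derivative is formally self-adjoint. -/
lemma integral_evolve_varDeriv (X Y : ι → R) (P : R) :
    S.integral ((S.evolve X ∘ S.varDeriv P) ⬝ᵥ Y) =
      S.integral ((S.evolve Y ∘ S.varDeriv P) ⬝ᵥ X) := by
  have h := congrArg S.integral (S.evolve_evolve_sub X Y P)
  rw [map_sub, map_sub, S.integral_evolve_evolve X Y, S.integral_evolve_evolve Y X,
    add_sub_add_comm, add_eq_right, sub_eq_zero] at h
  exact h

end JetAlgebra

section LinearMatrix

variable {𝕜 ι R : Type*} [CommRing 𝕜] [CommRing R] [Algebra 𝕜 R] [Fintype ι]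

/-- The matrix `ψ^γ_{ik} X^k`, linear in the vector `X`. -/
def linMat (ψ : ι → Matrix ι ι 𝕜) (X : ι → R) : Matrix ι ι R :=
  Matrix.of fun γ i => ∑ k, ψ γ i k • X k

variable {ψ : ι → Matrix ι ι 𝕜}

lemma map_linMat {R' : Type*} [CommRing R'] [Algebra 𝕜 R'] (e : R →ₗ[𝕜] R') (X : ι → R) :
    (linMat ψ X).map e = linMat ψ (e ∘ X) := by
  ext γ i
  simp [linMat]

lemma derivation_linMat (δ : Derivation 𝕜 R R) (X : ι → R) :
    (linMat ψ X).map δ = linMat ψ (δ ∘ X) :=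
  map_linMat (δ : R →ₗ[𝕜] R) X

lemma linMat_zero : linMat ψ (0 : ι → R) = 0 := by
  ext γ i
  simp [linMat]

lemma linMat_mulVec_comm (hψ : ∀ γ, (ψ γ)ᵀ = -ψ γ) (X Y : ι → R) :
    linMat ψ X *ᵥ Y = -(linMat ψ Y *ᵥ X) := by
  ext γ
  simp only [linMat, Matrix.mulVec, dotProduct, Matrix.of_apply, Pi.neg_apply, Finset.sum_mul,
    smul_mul_assoc, ← Finset.sum_neg_distrib]
  rw [Finset.sum_comm]
  refine Finset.sum_congr rfl fun i _ => Finset.sum_congr rfl fun k _ => ?_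
  rw [← Matrix.transpose_apply (ψ γ), hψ, Matrix.neg_apply, neg_smul, mul_comm]

end LinearMatrix

namespace JetAlgebra

variable {𝕜 ι R : Type*} [CommRing 𝕜] [CommRing R] [Algebra 𝕜 R] [Fintype ι]
  (S : JetAlgebra 𝕜 ι R)

lemma integral_dotProduct_mulVec_D (K : Matrix ι ι 𝕜) (v w : ι → R) :
    S.integral (v ⬝ᵥ (K.map (algebraMap 𝕜 R) *ᵥ (S.D ∘ w))) =
      -S.integral ((Kᵀ.map (algebraMap 𝕜 R) *ᵥ (S.D ∘ v)) ⬝ᵥ w) := by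
  rw [Matrix.dotProduct_mulVec, ← Matrix.mulVec_transpose, integral_dotProduct_D,
    ← Matrix.transpose_map, derivation_const_mulVec]

variable [DecidableEq ι]

/-- The first-order operator `M⁻¹ K D M⁻ᵀ` with `K` constant. -/
def factoredOp (M : Matrix ι ι R) (K : Matrix ι ι 𝕜) (π : ι → R) : ι → R :=
  M⁻¹ *ᵥ (K.map (algebraMap 𝕜 R) *ᵥ (S.D ∘ (M⁻¹ᵀ *ᵥ π)))

/-- The density of the bracket of the third-order operator `D M⁻¹ K D M⁻ᵀ D`. -/
def factoredBracket (M : Matrix ι ι R) (K : Matrix ι ι 𝕜) (P Q : R) : R :=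
  S.varDeriv P ⬝ᵥ (S.D ∘ S.factoredOp M K (S.D ∘ S.varDeriv Q))

variable {S} {M L : Matrix ι ι R} {K : Matrix ι ι 𝕜}

lemma factoredOp_transpose_mulVec (hM : IsUnit M.det) (s : ι → R) :
    S.factoredOp M K (Mᵀ *ᵥ s) = M⁻¹ *ᵥ (K.map (algebraMap 𝕜 R) *ᵥ (S.D ∘ s)) := by
  rw [factoredOp, Matrix.mulVec_mulVec s, ← Matrix.transpose_mul, Matrix.mul_nonsing_inv M hM,
    Matrix.transpose_one, Matrix.one_mulVec]

lemma factoredOp_add (π ρ : ι → R) :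
    S.factoredOp M K (π + ρ) = S.factoredOp M K π + S.factoredOp M K ρ := by
  have hD : ∀ v w : ι → R, S.D ∘ (v + w) = S.D ∘ v + S.D ∘ w :=
    fun v w => funext fun i => map_add S.D (v i) (w i)
  simp only [factoredOp, Matrix.mulVec_add, hD]

lemma factoredOp_sub (π ρ : ι → R) :
    S.factoredOp M K (π - ρ) = S.factoredOp M K π - S.factoredOp M K ρ := by
  rw [eq_sub_iff_add_eq, ← factoredOp_add, sub_add_cancel]

/-- Both sides are the pairing of `M⁻ᵀ a` with `K D M⁻ᵀ b`, up to an integration by parts. -/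
lemma integral_dotProduct_factoredOp (hK : Kᵀ = K) (a b : ι → R) :
    S.integral (a ⬝ᵥ S.factoredOp M K b) = -S.integral (b ⬝ᵥ S.factoredOp M K a) := by
  have pairing : ∀ v w : ι → R, v ⬝ᵥ (M⁻¹ *ᵥ w) = (M⁻¹ᵀ *ᵥ v) ⬝ᵥ w := fun v w => by
    rw [Matrix.dotProduct_mulVec, Matrix.mulVec_transpose]
  rw [factoredOp, factoredOp, pairing, pairing, integral_dotProduct_mulVec_D, hK, dotProduct_comm]

lemma integral_factoredBracket_add (hK : Kᵀ = K) (P Q : R) :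
    S.integral (S.factoredBracket M K P Q + S.factoredBracket M K Q P) = 0 := by
  rw [map_add, factoredBracket, factoredBracket, integral_dotProduct_D, integral_dotProduct_D,
    integral_dotProduct_factoredOp hK, neg_neg, add_neg_cancel]

lemma derivation_factoredOp {δ : Derivation 𝕜 R R} (hδ : ∀ P, δ (S.D P) = S.D (δ P))
    (hM : IsUnit M.det) (hL : M.map δ = L) (π : ι → R) :
    δ ∘ S.factoredOp M K π = S.factoredOp M K (δ ∘ π) - M⁻¹ *ᵥ (L *ᵥ S.factoredOp M K π) -
      S.factoredOp M K (Lᵀ *ᵥ (M⁻¹ᵀ *ᵥ π)) := by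
  have hδ' : ∀ v : ι → R, δ ∘ (S.D ∘ v) = S.D ∘ (δ ∘ v) := fun v => funext fun i => hδ (v i)
  have hinv : M⁻¹ᵀ.map δ = -(M⁻¹ᵀ * Lᵀ * M⁻¹ᵀ) := by
    rw [Matrix.transpose_map, derivation_inv δ hM, hL, Matrix.transpose_neg,
      Matrix.transpose_mul, Matrix.transpose_mul, Matrix.mul_assoc]
  have inner : δ ∘ (S.D ∘ (M⁻¹ᵀ *ᵥ π)) =
      S.D ∘ (M⁻¹ᵀ *ᵥ (δ ∘ π - Lᵀ *ᵥ (M⁻¹ᵀ *ᵥ π))) := by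
    rw [hδ', derivation_mulVec, hinv, Matrix.mulVec_sub, Matrix.neg_mulVec, neg_add_eq_sub,
      Matrix.mulVec_mulVec, Matrix.mulVec_mulVec, Matrix.mul_assoc]
  rw [sub_right_comm, ← factoredOp_sub, factoredOp, derivation_mulVec δ M⁻¹,
    derivation_const_mulVec, inner, derivation_inv δ hM, hL,
    Matrix.neg_mulVec, ← Matrix.mulVec_mulVec, ← Matrix.mulVec_mulVec, neg_add_eq_sub]
  rfl

/-- The variation of the bracket `∫ a · D M⁻¹ K D M⁻ᵀ D b`: the last two terms are the
contribution of the operator itself. -/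
lemma integral_derivation_dotProduct_D_factoredOp (hK : Kᵀ = K) {δ : Derivation 𝕜 R R}
    (hδ : ∀ P, δ (S.D P) = S.D (δ P)) (hM : IsUnit M.det) (hL : M.map δ = L) (a b : ι → R) :
    S.integral (δ (a ⬝ᵥ (S.D ∘ S.factoredOp M K (S.D ∘ b)))) =
      S.integral ((δ ∘ a) ⬝ᵥ (S.D ∘ S.factoredOp M K (S.D ∘ b))) -
      S.integral ((δ ∘ b) ⬝ᵥ (S.D ∘ S.factoredOp M K (S.D ∘ a))) +
      S.integral ((M⁻¹ᵀ *ᵥ (S.D ∘ a)) ⬝ᵥ (L *ᵥ S.factoredOp M K (S.D ∘ b))) -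
      S.integral ((M⁻¹ᵀ *ᵥ (S.D ∘ b)) ⬝ᵥ (L *ᵥ S.factoredOp M K (S.D ∘ a))) := by
  have hδ' : ∀ v : ι → R, δ ∘ (S.D ∘ v) = S.D ∘ (δ ∘ v) := fun v => funext fun i => hδ (v i)
  have hvar := derivation_factoredOp (K := K) hδ hM hL (S.D ∘ b)
  rw [derivation_dotProduct, map_add, hδ', S.integral_dotProduct_D a, hvar, hδ', dotProduct_sub,
    dotProduct_sub, map_sub, map_sub, integral_dotProduct_factoredOp hK _ (S.D ∘ (δ ∘ b)),
    integral_dotProduct_factoredOp hK _ (Lᵀ *ᵥ _), Matrix.dotProduct_mulVec _ M⁻¹,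
    ← Matrix.mulVec_transpose, Matrix.mulVec_transpose L, ← Matrix.dotProduct_mulVec _ L,
    S.integral_dotProduct_D (δ ∘ b)]
  abel

variable {ψ : ι → Matrix ι ι 𝕜}

lemma integral_varDeriv_factoredBracket (hK : Kᵀ = K) (hM : IsUnit M.det)
    (hψM : ∀ X, M.map (S.evolve X) = linMat ψ X) (P Q : R) (X : ι → R) :
    S.integral (S.varDeriv (S.factoredBracket M K P Q) ⬝ᵥ X) =
      S.integral ((S.evolve X ∘ S.varDeriv P) ⬝ᵥ
        (S.D ∘ S.factoredOp M K (S.D ∘ S.varDeriv Q))) -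
      S.integral ((S.evolve X ∘ S.varDeriv Q) ⬝ᵥ
        (S.D ∘ S.factoredOp M K (S.D ∘ S.varDeriv P))) +
      S.integral ((M⁻¹ᵀ *ᵥ (S.D ∘ S.varDeriv P)) ⬝ᵥ
        (linMat ψ X *ᵥ S.factoredOp M K (S.D ∘ S.varDeriv Q))) -
      S.integral ((M⁻¹ᵀ *ᵥ (S.D ∘ S.varDeriv Q)) ⬝ᵥ
        (linMat ψ X *ᵥ S.factoredOp M K (S.D ∘ S.varDeriv P))) := by
  rw [dotProduct_comm, ← integral_evolve, factoredBracket]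
  exact integral_derivation_dotProduct_D_factoredOp hK (S.evolve_D X) hM (hψM X) _ _

/-- Integration by parts: `φ M` maps `M⁻¹ K D M⁻ᵀ π` to `D M⁻ᵀ π`, and by skew-symmetry `D (ψ(y) x)`
is the difference of the two other pairings. -/
lemma integral_dotProduct_linMat_D_mulVec {φ : Matrix ι ι 𝕜} (hφ : φ * K = 1) (hM : IsUnit M.det)
    (hψ : ∀ γ, (ψ γ)ᵀ = -ψ γ) (π x y : ι → R) :
    S.integral ((M⁻¹ᵀ *ᵥ π) ⬝ᵥ (linMat ψ (S.D ∘ y) *ᵥ x)) =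
      S.integral ((M⁻¹ᵀ *ᵥ π) ⬝ᵥ (linMat ψ (S.D ∘ x) *ᵥ y)) -
      S.integral ((φ.map (algebraMap 𝕜 R) *ᵥ (M *ᵥ S.factoredOp M K π)) ⬝ᵥ
        (linMat ψ y *ᵥ x)) := by
  have hφK : φ.map (algebraMap 𝕜 R) * K.map (algebraMap 𝕜 R) = 1 := by
    rw [← Matrix.map_mul, hφ, Matrix.map_one _ (map_zero _) (map_one _)]
  have hD : S.D ∘ (linMat ψ y *ᵥ x) =
      linMat ψ (S.D ∘ y) *ᵥ x - linMat ψ (S.D ∘ x) *ᵥ y := by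
    rw [derivation_mulVec, derivation_linMat, linMat_mulVec_comm hψ y (S.D ∘ x), sub_eq_add_neg]
  have hparts := S.integral_dotProduct_D (M⁻¹ᵀ *ᵥ π) (linMat ψ y *ᵥ x)
  rw [hD, dotProduct_sub, map_sub, sub_eq_iff_eq_add] at hparts
  rw [hparts, factoredOp, Matrix.mulVec_mulVec _ M, Matrix.mul_nonsing_inv _ hM,
    Matrix.one_mulVec, Matrix.mulVec_mulVec, hφK, Matrix.one_mulVec, neg_add_eq_sub]

theorem integral_factoredBracket_jacobi {φ : Matrix ι ι 𝕜} (hK : Kᵀ = K) (hφ : φ * K = 1)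
    (hM : IsUnit M.det) (hψ : ∀ γ, (ψ γ)ᵀ = -ψ γ) (hψM : ∀ X, M.map (S.evolve X) = linMat ψ X)
    (hcyc : ∀ x y z : ι → R,
      (φ.map (algebraMap 𝕜 R) *ᵥ (M *ᵥ x)) ⬝ᵥ (linMat ψ z *ᵥ y) +
      (φ.map (algebraMap 𝕜 R) *ᵥ (M *ᵥ y)) ⬝ᵥ (linMat ψ x *ᵥ z) +
      (φ.map (algebraMap 𝕜 R) *ᵥ (M *ᵥ z)) ⬝ᵥ (linMat ψ y *ᵥ x) = 0) (P Q T : R) :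
    S.integral (S.factoredBracket M K (S.factoredBracket M K P Q) T +
      S.factoredBracket M K (S.factoredBracket M K Q T) P +
      S.factoredBracket M K (S.factoredBracket M K T P) Q) = 0 := by
  have variation := fun P Q => integral_varDeriv_factoredBracket hK hM hψM P Q
  have parts := fun π x y => integral_dotProduct_linMat_D_mulVec (S := S) hφ hM hψ π x y
  have expand : ∀ P Q, S.factoredBracket M K P Q =
      S.varDeriv P ⬝ᵥ (S.D ∘ S.factoredOp M K (S.D ∘ S.varDeriv Q)) := fun _ _ => rfl
  rw [map_add, map_add, expand (S.factoredBracket M K P Q) T,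
    expand (S.factoredBracket M K Q T) P, expand (S.factoredBracket M K T P) Q, variation,
    variation, variation]
  set p := S.factoredOp M K (S.D ∘ S.varDeriv P)
  set q := S.factoredOp M K (S.D ∘ S.varDeriv Q)
  set t := S.factoredOp M K (S.D ∘ S.varDeriv T)
  have cyclic := congrArg S.integral (hcyc p q t)
  rw [map_add, map_add, map_zero] at cyclic
  rw [parts _ q t, parts _ t p, parts _ p q, S.integral_evolve_varDeriv (S.D ∘ t) (S.D ∘ q),
    S.integral_evolve_varDeriv (S.D ∘ p) (S.D ∘ t),
    S.integral_evolve_varDeriv (S.D ∘ q) (S.D ∘ p), ← neg_eq_zero.2 cyclic]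
  abel

end JetAlgebra

section JetRepresentation

variable {n : ℕ}

lemma isOpenMap_jetTrunc (k : ℕ) : IsOpenMap (jetTrunc (n := n) k) := by
  refine IsOpenMap.of_sections fun q => ⟨fun x =>
    (x.1, fun j => if h : j < k then x.2 ⟨j, h⟩ else q.2 j), ?_, ?_, fun x => ?_⟩
  · refine (continuous_fst.prodMk (continuous_pi fun j => ?_)).continuousAt
    split_ifs <;> fun_prop
  · simp [jetTrunc]
  · simp [jetTrunc]

/-- Forgetting the highest jet coordinates. -/
def jetRestrict {k l : ℕ} (h : k ≤ l) :
    (ℝ × (Fin l → Fin n → ℝ)) →L[ℝ] (ℝ × (Fin k → Fin n → ℝ)) :=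
  (ContinuousLinearMap.fst ℝ _ _).prod
    (ContinuousLinearMap.pi fun j =>
      (ContinuousLinearMap.proj (Fin.castLE h j)).comp (ContinuousLinearMap.snd ℝ _ _))

lemma jetRestrict_jetTrunc {k l : ℕ} (h : k ≤ l) (q : Jet n) :
    jetRestrict h (jetTrunc l q) = jetTrunc k q := rfl

/-- The differential function `P` on `Ω` is represented by the smooth function `p` of jets of order
less than `k`. -/
structure IsRep (Ω : Set (Jet n)) (k : ℕ) (p : ℝ × (Fin k → Fin n → ℝ) → ℝ) (P : Jet n → ℝ) :
    Prop where
  contDiffOn : ContDiffOn ℝ (⊤ : ℕ∞) p (jetTrunc k '' Ω)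
  eq : ∀ q ∈ Ω, P q = p (jetTrunc k q)

variable {Ω : Set (Jet n)} {P Q : Jet n → ℝ}

lemma isDiffFun_iff_exists_isRep : IsDiffFun Ω P ↔ ∃ k p, IsRep Ω k p P :=
  ⟨fun ⟨k, p, hp, hP⟩ => ⟨k, p, hp, hP⟩, fun ⟨k, p, h⟩ => ⟨k, p, h.contDiffOn, h.eq⟩⟩

lemma contDiffOn_comp_jetRestrict {E : Type*} [NormedAddCommGroup E] [NormedSpace ℝ E] {k l : ℕ}
    {p : ℝ × (Fin k → Fin n → ℝ) → E} (h : k ≤ l)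
    (hp : ContDiffOn ℝ (⊤ : ℕ∞) p (jetTrunc k '' Ω)) :
    ContDiffOn ℝ (⊤ : ℕ∞) (fun x => p (jetRestrict h x)) (jetTrunc l '' Ω) := by
  refine hp.comp (jetRestrict h).contDiff.contDiffOn ?_
  rintro _ ⟨q, hq, rfl⟩
  exact ⟨q, hq, rfl⟩

lemma IsDiffFun.exists_isRep₂ (hP : IsDiffFun Ω P) (hQ : IsDiffFun Ω Q) :
    ∃ k p r, IsRep Ω k p P ∧ IsRep Ω k r Q := by
  obtain ⟨k, p, hp, hP⟩ := hP
  obtain ⟨l, r, hr, hQ⟩ := hQ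
  exact ⟨max k l, _, _, ⟨contDiffOn_comp_jetRestrict (le_max_left k l) hp, hP⟩,
    ⟨contDiffOn_comp_jetRestrict (le_max_right k l) hr, hQ⟩⟩

lemma IsDiffFun.add (hP : IsDiffFun Ω P) (hQ : IsDiffFun Ω Q) : IsDiffFun Ω (P + Q) := by
  obtain ⟨k, p, r, hp, hr⟩ := hP.exists_isRep₂ hQ
  exact ⟨k, p + r, hp.contDiffOn.add hr.contDiffOn, fun q hq =>
    congrArg₂ (· + ·) (hp.eq q hq) (hr.eq q hq)⟩

lemma IsDiffFun.mul (hP : IsDiffFun Ω P) (hQ : IsDiffFun Ω Q) : IsDiffFun Ω (P * Q) := by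
  obtain ⟨k, p, r, hp, hr⟩ := hP.exists_isRep₂ hQ
  exact ⟨k, p * r, hp.contDiffOn.mul hr.contDiffOn, fun q hq =>
    congrArg₂ (· * ·) (hp.eq q hq) (hr.eq q hq)⟩

lemma isDiffFun_const (c : ℝ) : IsDiffFun Ω (fun _ => c) :=
  ⟨0, fun _ => c, contDiffOn_const, fun _ _ => rfl⟩

lemma IsDiffFun.inv (hP : IsDiffFun Ω P) (h0 : ∀ q ∈ Ω, P q ≠ 0) : IsDiffFun Ω P⁻¹ := by
  obtain ⟨k, p, hp, hP⟩ := hP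
  refine ⟨k, fun x => (p x)⁻¹, hp.inv ?_, fun q hq => congrArg _ (hP q hq)⟩
  rintro _ ⟨q, hq, rfl⟩
  rw [← hP q hq]
  exact h0 q hq

lemma IsDiffFun.congr (hP : IsDiffFun Ω P) (h : ∀ q ∈ Ω, Q q = P q) : IsDiffFun Ω Q := by
  obtain ⟨k, p, hp, hP⟩ := hP
  exact ⟨k, p, hp, fun q hq => (h q hq).trans (hP q hq)⟩

lemma isDiffFun_fst : IsDiffFun Ω (fun q => q.1) :=
  ⟨0, fun x => x.1, contDiff_fst.contDiffOn, fun _ _ => rfl⟩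

lemma isDiffFun_coord (l : ℕ) (i : Fin n) : IsDiffFun Ω (fun q => q.2 l i) :=
  ⟨l + 1, fun x => x.2 (Fin.last l) i, ContDiff.contDiffOn (by fun_prop), fun _ _ => rfl⟩

section LineDeriv

variable {k l : ℕ} {p : ℝ × (Fin k → Fin n → ℝ) → ℝ} {q : Jet n}
  {w : Jet n → Jet n} {W : ℝ × (Fin l → Fin n → ℝ) → ℝ × (Fin k → Fin n → ℝ)}

lemma IsRep.contDiffAt (hΩ : IsOpen Ω) (hP : IsRep Ω k p P) (hq : q ∈ Ω) :
    ContDiffAt ℝ (⊤ : ℕ∞) p (jetTrunc k q) :=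
  hP.contDiffOn.contDiffAt ((isOpenMap_jetTrunc k _ hΩ).mem_nhds ⟨q, hq, rfl⟩)

lemma IsRep.hasLineDerivAt (hΩ : IsOpen Ω) (hP : IsRep Ω k p P) (hq : q ∈ Ω) (v : Jet n) :
    HasLineDerivAt ℝ P (fderiv ℝ p (jetTrunc k q) (jetTrunc k v)) q v := by
  have hline : Continuous fun s : ℝ => q + s • v := by fun_prop
  have hmem : ∀ᶠ s : ℝ in nhds 0, q + s • v ∈ Ω :=
    hline.continuousAt.eventually_mem (hΩ.mem_nhds (by simpa using hq))
  have hp := ((hP.contDiffAt hΩ hq).differentiableAt (by simp)).hasFDerivAt.hasLineDerivAt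
    (jetTrunc k v)
  refine HasDerivAt.congr_of_eventuallyEq hp ?_
  filter_upwards [hmem] with s hs
  exact hP.eq _ hs

lemma IsRep.lineDeriv_eq (hΩ : IsOpen Ω) (hP : IsRep Ω k p P) (hq : q ∈ Ω) (v : Jet n) :
    lineDeriv ℝ P q v = fderiv ℝ p (jetTrunc k q) (jetTrunc k v) :=
  (hP.hasLineDerivAt hΩ hq v).deriv

lemma IsRep.lineDeriv (hΩ : IsOpen Ω) (hP : IsRep Ω k p P) (hkl : k ≤ l)
    (hW : ContDiff ℝ (⊤ : ℕ∞) W) (hw : ∀ q, jetTrunc k (w q) = W (jetTrunc l q)) :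
    IsRep Ω l (fun x => fderiv ℝ p (jetRestrict hkl x) (W x)) fun q => lineDeriv ℝ P q (w q) where
  contDiffOn := (contDiffOn_comp_jetRestrict hkl (hP.contDiffOn.fderiv_of_isOpen
    (isOpenMap_jetTrunc k _ hΩ) (by simp))).clm_apply hW.contDiffOn
  eq q hq := by rw [hP.lineDeriv_eq hΩ hq, hw, jetRestrict_jetTrunc]

lemma IsRep.lineDeriv_lineDeriv (hΩ : IsOpen Ω) (hP : IsRep Ω k p P) (hkl : k ≤ l)
    (hW : ContDiff ℝ (⊤ : ℕ∞) W) (hw : ∀ q, jetTrunc k (w q) = W (jetTrunc l q)) (hq : q ∈ Ω)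
    (v : Jet n) :
    _root_.lineDeriv ℝ (fun r => _root_.lineDeriv ℝ P r (w r)) q v =
      fderiv ℝ (fderiv ℝ p) (jetTrunc k q) (jetTrunc k v) (jetTrunc k (w q)) +
        fderiv ℝ p (jetTrunc k q) (fderiv ℝ W (jetTrunc l q) (jetTrunc l v)) := by
  have hp : DifferentiableAt ℝ (fderiv ℝ p) (jetTrunc k q) :=
    ((hP.contDiffAt hΩ hq).fderiv_right (m := 1)
      (WithTop.coe_le_coe.2 (le_top : (2 : ℕ∞) ≤ ⊤))).differentiableAt one_ne_zero
  have hp' : HasFDerivAt (fun x => fderiv ℝ p (jetRestrict hkl x))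
      ((fderiv ℝ (fderiv ℝ p) (jetTrunc k q)).comp (jetRestrict hkl)) (jetTrunc l q) :=
    HasFDerivAt.comp (g := fderiv ℝ p) (jetTrunc l q) hp.hasFDerivAt (jetRestrict hkl).hasFDerivAt
  have hW' := (hW.differentiable (by simp) (jetTrunc l q)).hasFDerivAt
  rw [(hP.lineDeriv hΩ hkl hW hw).lineDeriv_eq hΩ hq, (hp'.clm_apply hW').fderiv, hw, add_comm]
  rfl

lemma IsRep.fderiv_fderiv_symm (hΩ : IsOpen Ω) (hP : IsRep Ω k p P) (hq : q ∈ Ω)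
    (v w : ℝ × (Fin k → Fin n → ℝ)) :
    fderiv ℝ (fderiv ℝ p) (jetTrunc k q) v w = fderiv ℝ (fderiv ℝ p) (jetTrunc k q) w v :=
  (hP.contDiffAt hΩ hq).isSymmSndFDerivAt (by
    rw [minSmoothness_of_isRCLikeNormedField]
    exact WithTop.coe_le_coe.2 (le_top : (2 : ℕ∞) ≤ ⊤)) v w

end LineDeriv

/-- The direction of the coordinate `u^i_l`. -/
def jetBasis (l : ℕ) (i : Fin n) : Jet n := (0, Pi.single l (Pi.single i 1))

/-- The direction `∂/∂x + ∑ u^i_{k+1} ∂/∂u^i_k` of the total derivative. -/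
def jetShift (q : Jet n) : Jet n := (1, fun j => q.2 (j + 1))

lemma partialX_eq_lineDeriv (P : Jet n → ℝ) (q : Jet n) :
    partialX P q = lineDeriv ℝ P q (1, 0) := by
  have h := deriv_comp_const_add (f := fun s => P (s, q.2)) q.1 0
  rw [add_zero] at h
  rw [partialX, ← h, lineDeriv]
  congr 1
  ext s
  congr 1
  ext <;> simp

lemma partialU_eq_lineDeriv (l : ℕ) (i : Fin n) (P : Jet n → ℝ) (q : Jet n) :
    partialU l i P q = lineDeriv ℝ P q (jetBasis l i) := by
  have h := deriv_comp_const_add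
    (f := fun s => P (q.1, Function.update q.2 l (Function.update (q.2 l) i s))) (q.2 l i) 0
  rw [add_zero] at h
  rw [partialU, ← h, lineDeriv]
  congr 1
  ext s
  congr 1
  refine Prod.ext (by simp [jetBasis]) (funext fun j => funext fun a => ?_)
  obtain rfl | hj := eq_or_ne j l
  · obtain rfl | ha := eq_or_ne a i <;> simp [jetBasis, *]
  · simp [jetBasis, hj]

lemma jetTrunc_jetBasis_of_le {k l : ℕ} (h : k ≤ l) (i : Fin n) :
    jetTrunc k (jetBasis l i) = 0 := by
  refine Prod.ext rfl (funext fun j => ?_)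
  have : (j : ℕ) ≠ l := by omega
  simp [jetTrunc, jetBasis, this]

lemma jetTrunc_jetShift_eq_sum (k : ℕ) (q : Jet n) :
    jetTrunc k (jetShift q) = jetTrunc k (1, 0) +
      ∑ l ∈ Finset.range k, ∑ i, q.2 (l + 1) i • jetTrunc k (jetBasis l i) := by
  refine Prod.ext ?_ (funext fun j => funext fun a => ?_)
  · simp [jetTrunc, jetShift, jetBasis, Prod.fst_sum]
  · simp [jetTrunc, jetShift, jetBasis, Prod.snd_sum, Finset.sum_apply, Pi.single_apply]

lemma IsDiffFun.totalD_eq_lineDeriv (hΩ : IsOpen Ω) (hP : IsDiffFun Ω P) {q : Jet n} (hq : q ∈ Ω) :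
    totalD P q = lineDeriv ℝ P q (jetShift q) := by
  obtain ⟨k, p, hp⟩ := isDiffFun_iff_exists_isRep.1 hP
  have partialU_eq := fun l i =>
    (partialU_eq_lineDeriv l i P q).trans (hp.lineDeriv_eq hΩ hq (jetBasis l i))
  rw [totalD, partialX_eq_lineDeriv, finsum_eq_sum_of_support_subset (s := Finset.range k),
    hp.lineDeriv_eq hΩ hq, hp.lineDeriv_eq hΩ hq, jetTrunc_jetShift_eq_sum]
  · simp only [map_add, map_sum, map_smul, smul_eq_mul, partialU_eq]
  · intro l hl
    contrapose! hl
    have hkl : k ≤ l := by simpa using hl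
    simp [partialU_eq, jetTrunc_jetBasis_of_le hkl]

/-- The linear part of the shift of truncated jets. -/
def truncShift (k : ℕ) : (ℝ × (Fin (k + 1) → Fin n → ℝ)) →L[ℝ] (ℝ × (Fin k → Fin n → ℝ)) :=
  (0 : _ →L[ℝ] ℝ).prod (ContinuousLinearMap.pi fun j =>
      (ContinuousLinearMap.proj j.succ).comp (ContinuousLinearMap.snd ℝ _ _))

lemma jetTrunc_jetShift (k : ℕ) (q : Jet n) :
    jetTrunc k (jetShift q) = jetTrunc k (1, 0) + truncShift k (jetTrunc (k + 1) q) :=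
  Prod.ext (by simp [jetTrunc, jetShift, truncShift])
    (funext fun j => by simp [jetTrunc, jetShift, truncShift])

lemma truncShift_jetBasis_zero (k : ℕ) (i : Fin n) :
    truncShift k (jetTrunc (k + 1) (jetBasis 0 i)) = 0 :=
  Prod.ext (by simp [truncShift]) (funext fun j => by simp [truncShift, jetTrunc, jetBasis])

lemma truncShift_jetBasis_succ (k l : ℕ) (i : Fin n) :
    truncShift k (jetTrunc (k + 1) (jetBasis (l + 1) i)) = jetTrunc k (jetBasis l i) :=
  Prod.ext (by simp [truncShift, jetTrunc, jetBasis])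
    (funext fun j => by simp [truncShift, jetTrunc, jetBasis, Pi.single_apply])

end JetRepresentation

section DiffAlg

variable {n : ℕ} {Ω : Set (Jet n)} {P Q : Jet n → ℝ}

variable (Ω) in
/-- The algebra of differential functions on `Ω`, as functions defined on `Ω` only. -/
def diffAlg : Subalgebra ℝ (Ω → ℝ) where
  carrier := {g | ∃ P, IsDiffFun Ω P ∧ ∀ q : Ω, P q = g q}
  mul_mem' := by
    rintro f g ⟨P, hP, hf⟩ ⟨Q, hQ, hg⟩
    exact ⟨_, hP.mul hQ, fun q => congrArg₂ (· * ·) (hf q) (hg q)⟩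
  add_mem' := by
    rintro f g ⟨P, hP, hf⟩ ⟨Q, hQ, hg⟩
    exact ⟨_, hP.add hQ, fun q => congrArg₂ (· + ·) (hf q) (hg q)⟩
  algebraMap_mem' c := ⟨_, isDiffFun_const c, fun _ => rfl⟩

/-- `P` is a function on the jet space with restriction `g` to `Ω`. -/
def Extends (P : Jet n → ℝ) (g : diffAlg Ω) : Prop := ∀ q : Ω, P q = g.1 q

lemma isDiffFun_iff_exists_extends : IsDiffFun Ω P ↔ ∃ g : diffAlg Ω, Extends P g := by
  refine ⟨fun h => ⟨⟨fun q => P q, P, h, fun _ => rfl⟩, fun _ => rfl⟩, ?_⟩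
  rintro ⟨⟨g, Q, hQ, hg⟩, hP⟩
  exact hQ.congr fun q hq => (hP ⟨q, hq⟩).trans (hg ⟨q, hq⟩).symm

lemma Extends.isDiffFun {g : diffAlg Ω} (h : Extends P g) : IsDiffFun Ω P :=
  isDiffFun_iff_exists_extends.2 ⟨g, h⟩

/-- The extension by zero of an element of `diffAlg Ω` to the jet space. -/
def extendByZero (g : diffAlg Ω) : Jet n → ℝ := Function.extend Subtype.val g.1 0

lemma extends_extendByZero (g : diffAlg Ω) : Extends (extendByZero g) g :=
  fun q => Subtype.val_injective.extend_apply g.1 0 q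

lemma Extends.add {f g : diffAlg Ω} (hP : Extends P f) (hQ : Extends Q g) :
    Extends (P + Q) (f + g) :=
  fun q => congrArg₂ (· + ·) (hP q) (hQ q)

lemma Extends.mul {f g : diffAlg Ω} (hP : Extends P f) (hQ : Extends Q g) :
    Extends (P * Q) (f * g) :=
  fun q => congrArg₂ (· * ·) (hP q) (hQ q)

lemma Extends.smul {g : diffAlg Ω} (c : ℝ) (hP : Extends P g) : Extends (c • P) (c • g) :=
  fun q => congrArg (c * ·) (hP q)

lemma Extends.eq_iff {f g : diffAlg Ω} (hP : Extends P f) (hQ : Extends Q g) :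
    f = g ↔ ∀ q ∈ Ω, P q = Q q := by
  refine ⟨fun h q hq => ?_, fun h => Subtype.ext (funext fun q => ?_)⟩
  · rw [hP ⟨q, hq⟩, hQ ⟨q, hq⟩, h]
  · rw [← hP, ← hQ, h q q.2]

lemma isUnit_of_forall_ne_zero {g : diffAlg Ω} (h : ∀ q, g.1 q ≠ 0) : IsUnit g := by
  have hP := extends_extendByZero g
  obtain ⟨r, hr⟩ := isDiffFun_iff_exists_extends.1
    (hP.isDiffFun.inv fun q hq => by rw [hP ⟨q, hq⟩]; exact h _)
  refine IsUnit.of_mul_eq_one r (Subtype.ext (funext fun q => ?_))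
  change g.1 q * r.1 q = 1
  rw [← hr, Pi.inv_apply, hP, mul_inv_cancel₀ (h q)]

lemma Extends.hasLineDerivAt {g : diffAlg Ω} (hΩ : IsOpen Ω) (hP : Extends P g) (q : Ω)
    (v : Jet n) : HasLineDerivAt ℝ P (lineDeriv ℝ P q v) q v := by
  obtain ⟨k, p, hp⟩ := isDiffFun_iff_exists_isRep.1 hP.isDiffFun
  exact (hp.hasLineDerivAt hΩ q.2 v).lineDifferentiableAt.hasLineDerivAt

lemma lineDeriv_extendByZero {g : diffAlg Ω} (hΩ : IsOpen Ω) (hP : Extends P g) (q : Ω)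
    (v : Jet n) : lineDeriv ℝ (extendByZero g) q v = lineDeriv ℝ P q v := by
  refine Filter.EventuallyEq.deriv_eq ?_
  have hline : Continuous fun s : ℝ => (q : Jet n) + s • v := by fun_prop
  filter_upwards [hline.continuousAt.eventually_mem (hΩ.mem_nhds (by simp))] with s hs
  rw [extends_extendByZero g ⟨_, hs⟩, hP ⟨_, hs⟩]

/-- The vector field `w` on the jet space preserves differential functions on `Ω`. -/
def PreservesDiffFun (Ω : Set (Jet n)) (w : Jet n → Jet n) : Prop :=
  ∀ P, IsDiffFun Ω P → IsDiffFun Ω fun q => lineDeriv ℝ P q (w q)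

variable {w : Jet n → Jet n}

/-- The derivation of `diffAlg Ω` defined by a vector field on the jet space. -/
def fieldDerivation (hΩ : IsOpen Ω) (hw : PreservesDiffFun Ω w) :
    Derivation ℝ (diffAlg Ω) (diffAlg Ω) :=
  Derivation.mk'
    { toFun := fun g => ⟨fun q => lineDeriv ℝ (extendByZero g) q (w q), _,
        hw _ (extends_extendByZero g).isDiffFun, fun _ => rfl⟩
      map_add' := fun f g => by
        have hf := extends_extendByZero f
        have hg := extends_extendByZero g
        refine Subtype.ext (funext fun q => ?_)
        exact (lineDeriv_extendByZero hΩ (hf.add hg) q _).trans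
          (HasDerivAt.add (hf.hasLineDerivAt hΩ q _) (hg.hasLineDerivAt hΩ q _)).deriv
      map_smul' := fun c g => by
        have hg := extends_extendByZero g
        refine Subtype.ext (funext fun q => ?_)
        exact (lineDeriv_extendByZero hΩ (hg.smul c) q _).trans
          (HasDerivAt.const_smul c (hg.hasLineDerivAt hΩ q _)).deriv }
    fun f g => by
      have hf := extends_extendByZero f
      have hg := extends_extendByZero g
      refine Subtype.ext (funext fun q => (lineDeriv_extendByZero hΩ (hf.mul hg) q _).trans
        ((HasDerivAt.mul (hf.hasLineDerivAt hΩ q _) (hg.hasLineDerivAt hΩ q _)).deriv.trans ?_))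
      rw [zero_smul, add_zero, hf, hg, add_comm]
      exact congrArg₂ (· + ·) rfl (mul_comm _ _)

lemma Extends.fieldDerivation {g : diffAlg Ω} (hΩ : IsOpen Ω) (hw : PreservesDiffFun Ω w)
    (hP : Extends P g) :
    Extends (fun q => lineDeriv ℝ P q (w q)) (fieldDerivation hΩ hw g) :=
  fun q => (lineDeriv_extendByZero hΩ hP q _).symm

lemma preservesDiffFun_const (hΩ : IsOpen Ω) (v : Jet n) : PreservesDiffFun Ω fun _ => v := by
  intro P hP
  obtain ⟨k, p, hp⟩ := isDiffFun_iff_exists_isRep.1 hP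
  exact isDiffFun_iff_exists_isRep.2 ⟨k, _, hp.lineDeriv hΩ le_rfl contDiff_const fun _ => rfl⟩

lemma preservesDiffFun_jetShift (hΩ : IsOpen Ω) : PreservesDiffFun Ω jetShift := by
  intro P hP
  obtain ⟨k, p, hp⟩ := isDiffFun_iff_exists_isRep.1 hP
  exact isDiffFun_iff_exists_isRep.2 ⟨k + 1, _, hp.lineDeriv hΩ k.le_succ
    (contDiff_const.add (truncShift k).contDiff) (jetTrunc_jetShift k)⟩

lemma IsDiffFun.lineDeriv_comm (hΩ : IsOpen Ω) (hP : IsDiffFun Ω P) {q : Jet n} (hq : q ∈ Ω)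
    (v w : Jet n) :
    lineDeriv ℝ (fun r => lineDeriv ℝ P r w) q v =
      lineDeriv ℝ (fun r => lineDeriv ℝ P r v) q w := by
  obtain ⟨k, p, hp⟩ := isDiffFun_iff_exists_isRep.1 hP
  rw [hp.lineDeriv_lineDeriv hΩ le_rfl contDiff_const (fun _ => rfl) hq,
    hp.lineDeriv_lineDeriv hΩ le_rfl contDiff_const (fun _ => rfl) hq,
    hp.fderiv_fderiv_symm hΩ hq]
  simp

lemma IsRep.lineDeriv_jetShift_comm {k : ℕ} {p : ℝ × (Fin k → Fin n → ℝ) → ℝ} (hΩ : IsOpen Ω)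
    (hp : IsRep Ω k p P) {q : Jet n} (hq : q ∈ Ω) (v : Jet n) :
    _root_.lineDeriv ℝ (fun r => _root_.lineDeriv ℝ P r (jetShift r)) q v =
      _root_.lineDeriv ℝ (fun r => _root_.lineDeriv ℝ P r v) q (jetShift q) +
        fderiv ℝ p (jetTrunc k q) (truncShift k (jetTrunc (k + 1) v)) := by
  rw [hp.lineDeriv_lineDeriv hΩ k.le_succ (contDiff_const.add (truncShift k).contDiff)
      (jetTrunc_jetShift k) hq,
    hp.lineDeriv_lineDeriv hΩ le_rfl contDiff_const (fun _ => rfl) hq,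
    hp.fderiv_fderiv_symm hΩ hq]
  simp

/-- Differential functions on an open set of jets form a `JetAlgebra`. -/
def jetAlg (hΩ : IsOpen Ω) : JetAlgebra ℝ (Fin n) (diffAlg Ω) where
  D := fieldDerivation hΩ (preservesDiffFun_jetShift hΩ)
  d l i := fieldDerivation hΩ (preservesDiffFun_const hΩ (jetBasis l i))
  d_comm l i l' i' g := by
    have hg := extends_extendByZero g
    refine (((hg.fieldDerivation hΩ _).fieldDerivation hΩ _).eq_iff
      ((hg.fieldDerivation hΩ _).fieldDerivation hΩ _)).2 fun q hq => ?_
    exact hg.isDiffFun.lineDeriv_comm hΩ hq _ _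
  d_zero_D i g := by
    have hg := extends_extendByZero g
    obtain ⟨k, p, hp⟩ := isDiffFun_iff_exists_isRep.1 hg.isDiffFun
    refine (((hg.fieldDerivation hΩ _).fieldDerivation hΩ _).eq_iff
      ((hg.fieldDerivation hΩ _).fieldDerivation hΩ _)).2 fun q hq => ?_
    rw [hp.lineDeriv_jetShift_comm hΩ hq, truncShift_jetBasis_zero, map_zero, add_zero]
  d_succ_D l i g := by
    have hg := extends_extendByZero g
    obtain ⟨k, p, hp⟩ := isDiffFun_iff_exists_isRep.1 hg.isDiffFun
    refine (((hg.fieldDerivation hΩ _).fieldDerivation hΩ _).eq_iff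
      (((hg.fieldDerivation hΩ _).fieldDerivation hΩ _).add
        (hg.fieldDerivation hΩ _))).2 fun q hq => ?_
    rw [hp.lineDeriv_jetShift_comm hΩ hq, truncShift_jetBasis_succ, Pi.add_apply,
      hp.lineDeriv_eq hΩ hq]
  exists_order g := by
    have hg := extends_extendByZero g
    obtain ⟨k, p, hp⟩ := isDiffFun_iff_exists_isRep.1 hg.isDiffFun
    refine ⟨k, fun l hl i => Subtype.ext (funext fun q => ?_)⟩
    refine (hg.fieldDerivation hΩ _ q).symm.trans ((hp.lineDeriv_eq hΩ q.2 _).trans ?_)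
    rw [jetTrunc_jetBasis_of_le hl, map_zero]
    rfl

variable {g : diffAlg Ω}

lemma Extends.totalD (hΩ : IsOpen Ω) (hP : Extends P g) :
    Extends (totalD P) ((jetAlg hΩ).D g) := fun q => by
  rw [hP.isDiffFun.totalD_eq_lineDeriv hΩ q.2]
  exact hP.fieldDerivation hΩ (preservesDiffFun_jetShift hΩ) q

lemma Extends.partialU (hΩ : IsOpen Ω) (hP : Extends P g) (l : ℕ) (i : Fin n) :
    Extends (partialU l i P) ((jetAlg hΩ).d l i g) := fun q => by
  rw [partialU_eq_lineDeriv]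
  exact hP.fieldDerivation hΩ (preservesDiffFun_const hΩ _) q

lemma Extends.iterate_totalD (hΩ : IsOpen Ω) (hP : Extends P g) (k : ℕ) :
    Extends (WDVV.totalD^[k] P) ((jetAlg hΩ).D^[k] g) := by
  induction k with
  | zero => exact hP
  | succ k ih =>
    rw [Function.iterate_succ_apply', Function.iterate_succ_apply']
    exact ih.totalD hΩ

lemma Extends.varD (hΩ : IsOpen Ω) (hP : Extends P g) (i : Fin n) :
    Extends (varD i P) ((jetAlg hΩ).varDeriv g i) := fun q => by
  obtain ⟨K, hK⟩ := (jetAlg hΩ).exists_order g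
  have hterm : ∀ k, WDVV.totalD^[k] (WDVV.partialU k i P) q =
      ((jetAlg hΩ).D^[k] ((jetAlg hΩ).d k i g)).1 q :=
    fun k => (hP.partialU hΩ k i).iterate_totalD hΩ k q
  rw [(jetAlg hΩ).varDeriv_eq_sum hK, WDVV.varD,
    finsum_eq_sum_of_support_subset (s := Finset.range K)]
  · simp [hterm]
  · intro k hk
    contrapose! hk
    have hKk : K ≤ k := by simpa using hk
    simp [hterm, hK k hKk, iterate_map_zero]

lemma Extends.isTotalDerivative_iff (hΩ : IsOpen Ω) (hP : Extends P g) :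
    IsTotalDerivative Ω P ↔ (jetAlg hΩ).integral g = 0 := by
  rw [JetAlgebra.integral_eq_zero_iff]
  constructor
  · rintro ⟨T, hT, hPT⟩
    obtain ⟨τ, hτ⟩ := isDiffFun_iff_exists_extends.1 hT
    exact ⟨τ, ((hτ.totalD hΩ).eq_iff hP).2 fun q hq => (hPT q hq).symm⟩
  · rintro ⟨τ, hτ⟩
    have hext := extends_extendByZero τ
    exact ⟨_, hext.isDiffFun, fun q hq =>
      (((hext.totalD hΩ).eq_iff hP).1 hτ q hq).symm⟩

variable (Ω) in
/-- The coordinate `u^i_l` as an element of the algebra of differential functions. -/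
def coordAlg (l : ℕ) (i : Fin n) : diffAlg Ω :=
  ⟨fun q => q.1.2 l i, _, isDiffFun_coord l i, fun _ => rfl⟩

variable (Ω) in
/-- The independent variable as an element of the algebra of differential functions. -/
def xAlg : diffAlg Ω := ⟨fun q => q.1.1, _, isDiffFun_fst, fun _ => rfl⟩

lemma extends_coordAlg (l : ℕ) (i : Fin n) : Extends (fun q => q.2 l i) (coordAlg Ω l i) :=
  fun _ => rfl

lemma extends_xAlg : Extends (fun q => q.1) (xAlg Ω) := fun _ => rfl

lemma lineDeriv_coord (l : ℕ) (i : Fin n) (q v : Jet n) :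
    lineDeriv ℝ (fun r : Jet n => r.2 l i) q v = v.2 l i := by
  simp [lineDeriv]

lemma lineDeriv_fst (q v : Jet n) : lineDeriv ℝ (fun r : Jet n => r.1) q v = v.1 := by
  simp [lineDeriv]

lemma D_coordAlg (hΩ : IsOpen Ω) (l : ℕ) (i : Fin n) :
    (jetAlg hΩ).D (coordAlg Ω l i) = coordAlg Ω (l + 1) i :=
  (((extends_coordAlg l i).fieldDerivation hΩ (preservesDiffFun_jetShift hΩ)).eq_iff
    (extends_coordAlg (l + 1) i)).2 fun q _ => lineDeriv_coord l i q (jetShift q)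

lemma D_xAlg (hΩ : IsOpen Ω) : (jetAlg hΩ).D (xAlg Ω) = 1 :=
  ((extends_xAlg.fieldDerivation hΩ (preservesDiffFun_jetShift hΩ)).eq_iff (Q := 1)
    fun _ => rfl).2 fun q _ => lineDeriv_fst q (jetShift q)

lemma d_coordAlg (hΩ : IsOpen Ω) (k : ℕ) (j : Fin n) (l : ℕ) (i : Fin n) :
    (jetAlg hΩ).d k j (coordAlg Ω l i) = if l = k ∧ i = j then 1 else 0 := by
  refine Subtype.ext (funext fun q => ?_)
  have h := (extends_coordAlg l i).fieldDerivation hΩ (preservesDiffFun_const hΩ (jetBasis k j)) q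
  refine h.symm.trans ((lineDeriv_coord l i q (jetBasis k j)).trans ?_)
  obtain rfl | hl := eq_or_ne l k
  · obtain rfl | hi := eq_or_ne i j <;> simp [jetBasis, *]
  · simp [jetBasis, hl]

lemma d_xAlg (hΩ : IsOpen Ω) (k : ℕ) (j : Fin n) : (jetAlg hΩ).d k j (xAlg Ω) = 0 :=
  ((extends_xAlg.fieldDerivation hΩ (preservesDiffFun_const hΩ (jetBasis k j))).eq_iff (Q := 0)
    fun _ => rfl).2 fun q _ => lineDeriv_fst q (jetBasis k j)

lemma evolve_coordAlg (hΩ : IsOpen Ω) (X : Fin n → diffAlg Ω) :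
    (jetAlg hΩ).evolve X ∘ coordAlg Ω 0 = X := by
  funext i
  rw [Function.comp_apply, JetAlgebra.evolve_eq_sum (K := 1)]
  · simp [d_coordAlg]
  · intro k hk j
    rw [d_coordAlg, if_neg (by omega)]

end DiffAlg

section Evaluation

variable {n : ℕ} {Ω : Set (Jet n)}

/-- Evaluation of differential functions at a point. -/
def evalAt (q : Ω) : diffAlg Ω →ₐ[ℝ] ℝ := (Pi.evalAlgHom ℝ (fun _ : Ω => ℝ) q).comp (diffAlg Ω).val

lemma diffAlg_ext {f g : diffAlg Ω} (h : ∀ q, evalAt q f = evalAt q g) : f = g :=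
  Subtype.ext (funext h)

end Evaluation

section AlgHom

variable {𝕜 ι R R' : Type*} [CommRing 𝕜] [Fintype ι] [CommRing R] [Algebra 𝕜 R] [CommRing R']
  [Algebra 𝕜 R'] (e : R →ₐ[𝕜] R')

lemma algHom_dotProduct (v w : ι → R) : e (v ⬝ᵥ w) = (e ∘ v) ⬝ᵥ (e ∘ w) :=
  RingHom.map_dotProduct (e : R →+* R') v w

lemma algHom_comp_mulVec {κ : Type*} (M : Matrix κ ι R) (v : ι → R) :
    e ∘ (M *ᵥ v) = M.map e *ᵥ (e ∘ v) :=
  funext (RingHom.map_mulVec (e : R →+* R') M v)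

lemma map_nonsing_inv_algHom [DecidableEq ι] {M : Matrix ι ι R} (hM : IsUnit M.det) :
    M⁻¹.map e = (M.map e)⁻¹ := by
  refine (Matrix.inv_eq_left_inv ?_).symm
  rw [← Matrix.map_mul, Matrix.nonsing_inv_mul M hM, Matrix.map_one e (map_zero e) (map_one e)]

end AlgHom

lemma map_map_algHom {𝕜 ι κ R : Type*} [CommRing 𝕜] [CommRing R] [Algebra 𝕜 R] (e : R →ₐ[𝕜] 𝕜)
    (K : Matrix κ ι 𝕜) : (K.map (algebraMap 𝕜 R)).map e = K := by
  ext i j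
  simp

lemma algHom_comp_algebraMap_comp {𝕜 ι R : Type*} [CommRing 𝕜] [CommRing R] [Algebra 𝕜 R]
    (e : R →ₐ[𝕜] 𝕜) (v : ι → 𝕜) : e ∘ (algebraMap 𝕜 R ∘ v) = v :=
  funext fun i => e.commutes (v i)

section Cyclic

variable {𝕜 ι R : Type*} [CommRing 𝕜] [Fintype ι] [CommRing R] [Algebra 𝕜 R]

/-- The trilinear form `N^γ_i ψ^γ_{jk} x^i y^j z^k` has vanishing cyclic sum. -/
def IsCyclic (ψ : ι → Matrix ι ι 𝕜) (N : Matrix ι ι R) : Prop :=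
  ∀ x y z : ι → R, (N *ᵥ x) ⬝ᵥ (linMat ψ z *ᵥ y) + (N *ᵥ y) ⬝ᵥ (linMat ψ x *ᵥ z) +
    (N *ᵥ z) ⬝ᵥ (linMat ψ y *ᵥ x) = 0

lemma isCyclic_of_evalAt {n : ℕ} {Ω : Set (Jet n)} {ψ : Fin n → Matrix (Fin n) (Fin n) ℝ}
    {N : Matrix (Fin n) (Fin n) (diffAlg Ω)} (h : ∀ q, IsCyclic ψ (N.map (evalAt q))) :
    IsCyclic ψ N := fun x y z => diffAlg_ext fun q => by
  have hlin : ∀ X, (linMat ψ X).map (evalAt q) = linMat ψ (evalAt q ∘ X) :=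
    map_linMat (evalAt q : diffAlg Ω →ₗ[ℝ] ℝ)
  simp only [map_add, algHom_dotProduct, algHom_comp_mulVec, hlin, map_zero]
  exact h q _ _ _

end Cyclic

lemma JetAlgebra.factoredOp_eq {𝕜 ι R : Type*} [CommRing 𝕜] [CommRing R] [Algebra 𝕜 R] [Fintype ι]
    [DecidableEq ι] {S : JetAlgebra 𝕜 ι R} {M : Matrix ι ι R} (hM : IsUnit M.det)
    (K : Matrix ι ι 𝕜) (π : ι → R) :
    S.factoredOp M K π = (M⁻¹ * K.map (algebraMap 𝕜 R) * M⁻¹ᵀ) *ᵥ (S.D ∘ π) -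
      (M⁻¹ * K.map (algebraMap 𝕜 R) * M⁻¹ᵀ * (M.map S.D)ᵀ * M⁻¹ᵀ) *ᵥ π := by
  have hinv : M⁻¹ᵀ.map S.D = -(M⁻¹ᵀ * ((M.map S.D)ᵀ * M⁻¹ᵀ)) := by
    rw [Matrix.transpose_map, derivation_inv S.D hM, Matrix.transpose_neg,
      Matrix.transpose_mul, Matrix.transpose_mul]
  rw [factoredOp, derivation_mulVec, hinv, Matrix.neg_mulVec, neg_add_eq_sub, Matrix.mulVec_sub,
    Matrix.mulVec_sub]
  simp only [Matrix.mulVec_mulVec, Matrix.mul_assoc]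

lemma transpose_mul_apply_eq_dotProduct {ι R : Type*} [Fintype ι] [DecidableEq ι] [CommRing R]
    (A B : Matrix ι ι R) (i j : ι) :
    (Aᵀ * B) i j = (A *ᵥ Pi.single i 1) ⬝ᵥ (B *ᵥ Pi.single j 1) := by
  rw [Matrix.mulVec_single_one, Matrix.mulVec_single_one]
  rfl

lemma mul_linMat_apply {𝕜 ι R : Type*} [CommRing 𝕜] [Fintype ι] [DecidableEq ι] [CommRing R]
    [Algebra 𝕜 R] {ψ : ι → Matrix ι ι 𝕜} (N : Matrix ι ι R) (w : ι → R) (i j : ι) :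
    (N * linMat ψ w) i j = ∑ k, (N * linMat ψ (Pi.single k 1) : Matrix ι ι R) i j * w k := by
  have hlin : linMat ψ w = ∑ k, w k • linMat ψ (Pi.single k 1) := by
    ext γ i
    simp [linMat, Matrix.sum_apply, Pi.single_apply]
  rw [hlin, Matrix.mul_sum, Matrix.sum_apply]
  simp [mul_comm]

namespace LineCongruence

variable {n : ℕ} {C : LineCongruence n} {φ : Matrix (Fin n) (Fin n) ℝ}

/-- The conditions on a congruence and a constant symmetric matrix `φ` under which the metric
`φ_{αβ} ψ^α_i ψ^β_j` defines a Hamiltonian operator of third order. -/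
structure IsMonge (C : LineCongruence n) (φ : Matrix (Fin n) (Fin n) ℝ) : Prop where
  symm : φᵀ = φ
  det_ne_zero : φ.det ≠ 0
  skew : ∀ γ, (C.psi γ)ᵀ = -C.psi γ
  cyclic : ∀ u, IsCyclic C.psi (φ * C.psiMat u)

section Geometry

lemma psiMat_eq (C : LineCongruence n) (u : Fin n → ℝ) :
    C.psiMat u = linMat C.psi u + C.omega := by
  ext γ i
  simp [psiMat, linMat]

lemma psiMat_add_smul (C : LineCongruence n) (u x : Fin n → ℝ) (t : ℝ) :
    C.psiMat (u + t • x) = C.psiMat u + t • linMat C.psi x := by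
  ext γ i
  simp only [psiMat, linMat, Matrix.of_apply, Pi.add_apply, Pi.smul_apply, smul_eq_mul,
    Matrix.add_apply, Matrix.smul_apply, mul_add, Finset.sum_add_distrib, Finset.mul_sum,
    mul_left_comm t]
  ring

lemma contDiff_psiMat (C : LineCongruence n) {k : WithTop ℕ∞} (γ i : Fin n) :
    ContDiff ℝ k fun u => C.psiMat u γ i := by
  simp only [psiMat, Matrix.of_apply]
  fun_prop

lemma isOpen_regular (C : LineCongruence n) : IsOpen C.regular :=
  isOpen_compl_singleton.preimage (Continuous.matrix_det
    (continuous_matrix fun γ i => (C.contDiff_psiMat (k := 0) γ i).continuous))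

lemma fderiv_monge (C : LineCongruence n) (φ : Matrix (Fin n) (Fin n) ℝ) (u x : Fin n → ℝ)
    (s m : Fin n) :
    fderiv ℝ (fun w => C.monge φ w s m) u x =
      ((linMat C.psi x)ᵀ * φ * C.psiMat u + (C.psiMat u)ᵀ * φ * linMat C.psi x) s m := by
  have hdiff : DifferentiableAt ℝ (fun w => C.monge φ w s m) u := by
    have := fun γ i => (C.contDiff_psiMat (k := 1) γ i).differentiable one_ne_zero
    simp only [monge, Matrix.mul_apply, Matrix.transpose_apply]
    fun_prop
  have expansion : ∀ t : ℝ, C.monge φ (u + t • x) s m = C.monge φ u s m +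
      t * ((linMat C.psi x)ᵀ * φ * C.psiMat u + (C.psiMat u)ᵀ * φ * linMat C.psi x) s m +
      t ^ 2 * ((linMat C.psi x)ᵀ * φ * linMat C.psi x) s m := fun t => by
    simp only [monge, psiMat_add_smul, Matrix.transpose_add, Matrix.transpose_smul, Matrix.add_mul,
      Matrix.mul_add, Matrix.smul_mul, Matrix.mul_smul, Matrix.add_apply, Matrix.smul_apply,
      smul_eq_mul]
    ring
  rw [← hdiff.lineDeriv_eq_fderiv, lineDeriv, funext expansion]
  refine HasDerivAt.deriv ?_
  generalize C.monge φ u s m = a, ((linMat C.psi x)ᵀ * φ * C.psiMat u +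
    (C.psiMat u)ᵀ * φ * linMat C.psi x) s m = b, ((linMat C.psi x)ᵀ * φ * linMat C.psi x) s m = c
  exact (((hasDerivAt_const (0 : ℝ) a).add ((hasDerivAt_id 0).mul_const b)).add
    ((hasDerivAt_pow 2 (0 : ℝ)).mul_const c)).congr_deriv (by simp)

lemma IsMonge.lowerC_eq (hC : C.IsMonge φ) (u : Fin n → ℝ) (s k m : Fin n) :
    lowerC (C.monge φ) u s k m =
      -((φ * C.psiMat u)ᵀ * linMat C.psi (Pi.single m 1) : Matrix (Fin n) (Fin n) ℝ) s k := by
  have cyclic := hC.cyclic u (Pi.single s 1) (Pi.single k 1) (Pi.single m 1)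
  have hφΨ : (C.psiMat u)ᵀ * φ = (φ * C.psiMat u)ᵀ := by rw [Matrix.transpose_mul, hC.symm]
  rw [lowerC, fderiv_monge, fderiv_monge, hφΨ, Matrix.mul_assoc, Matrix.mul_assoc,
    Matrix.add_apply, Matrix.add_apply]
  simp only [transpose_mul_apply_eq_dotProduct]
  rw [linMat_mulVec_comm hC.skew (Pi.single k 1) (Pi.single m 1),
    linMat_mulVec_comm hC.skew (Pi.single m 1) (Pi.single s 1), dotProduct_neg, neg_dotProduct,
    dotProduct_comm (linMat _ _ *ᵥ _), dotProduct_comm (linMat _ _ *ᵥ _)]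
  linarith

lemma monge_inv (C : LineCongruence n) (φ : Matrix (Fin n) (Fin n) ℝ) (u : Fin n → ℝ) :
    (C.monge φ u)⁻¹ = (C.psiMat u)⁻¹ * φ⁻¹ * (C.psiMat u)⁻¹ᵀ := by
  rw [monge, Matrix.mul_inv_rev, Matrix.mul_inv_rev, Matrix.transpose_nonsing_inv,
    Matrix.mul_assoc]

lemma IsMonge.sum_upperC (hC : C.IsMonge φ) {u : Fin n → ℝ} (hu : u ∈ C.regular)
    (w : Fin n → ℝ) (i j : Fin n) :
    ∑ k, upperC (C.monge φ) u i j k * w k =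
      -((C.monge φ u)⁻¹ * (linMat C.psi w)ᵀ * (C.psiMat u)⁻¹ᵀ) i j := by
  have lower : ∀ a b, ∑ k, lowerC (C.monge φ) u a b k * w k =
      -((φ * C.psiMat u)ᵀ * linMat C.psi w) a b := fun a b => by
    simp only [hC.lowerC_eq, neg_mul, Finset.sum_neg_distrib, mul_linMat_apply _ w]
  have inverse : (C.monge φ u)⁻¹ * (φ * C.psiMat u)ᵀ = (C.psiMat u)⁻¹ := by
    have hunit : IsUnit (φ * C.psiMat u)ᵀ.det := by
      rw [Matrix.det_transpose, Matrix.det_mul]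
      exact (mul_ne_zero hC.det_ne_zero hu).isUnit
    rw [monge, ← hC.symm, ← Matrix.transpose_mul, hC.symm, Matrix.mul_inv_rev, Matrix.mul_assoc,
      Matrix.nonsing_inv_mul _ hunit, Matrix.mul_one]
  set f := C.monge φ u
  calc ∑ k, upperC (C.monge φ) u i j k * w k
      = ∑ a, ∑ b, f⁻¹ j a * f⁻¹ i b * ∑ k, lowerC (C.monge φ) u a b k * w k := by
        simp only [upperC, Finset.sum_mul, Finset.mul_sum, mul_assoc]
        rw [Finset.sum_comm]
        exact Finset.sum_congr rfl fun a _ => Finset.sum_comm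
    _ = -(f⁻¹ * ((φ * C.psiMat u)ᵀ * linMat C.psi w) * f⁻¹ᵀ) j i := by
        simp only [lower, Matrix.mul_apply (N := f⁻¹ᵀ), Matrix.mul_apply (M := f⁻¹),
          Finset.sum_mul, mul_neg, Finset.sum_neg_distrib, Matrix.transpose_apply]
        rw [Finset.sum_comm]
        simp only [mul_right_comm]
    _ = -((C.psiMat u)⁻¹ * linMat C.psi w * f⁻¹ᵀ)ᵀ i j := by
        rw [← Matrix.mul_assoc, inverse, Matrix.transpose_apply]
    _ = -(f⁻¹ * (linMat C.psi w)ᵀ * (C.psiMat u)⁻¹ᵀ) i j := by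
        rw [Matrix.transpose_mul, Matrix.transpose_mul, Matrix.transpose_transpose,
          Matrix.mul_assoc]

end Geometry

end LineCongruence

namespace LineCongruence

variable {n : ℕ} {C : LineCongruence n} {φ : Matrix (Fin n) (Fin n) ℝ}

section AffineMatrix

variable {R : Type*} [CommRing R] [Algebra ℝ R]

/-- The matrix `ψ^γ_i(u)` for fields `u` with values in a real algebra. -/
def affMat (C : LineCongruence n) (u : Fin n → R) : Matrix (Fin n) (Fin n) R :=
  linMat C.psi u + C.omega.map (algebraMap ℝ R)

lemma map_affMat (e : R →ₐ[ℝ] ℝ) (u : Fin n → R) : (C.affMat u).map e = C.psiMat (e ∘ u) := by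
  rw [affMat, Matrix.map_add e (map_add e), map_map_algHom, psiMat_eq]
  exact congrArg (· + C.omega) (map_linMat (e : R →ₗ[ℝ] ℝ) u)

lemma derivation_affMat (δ : Derivation ℝ R R) (u : Fin n → R) :
    (C.affMat u).map δ = linMat C.psi (δ ∘ u) := by
  rw [affMat, Matrix.map_add δ (map_add δ), derivation_linMat]
  ext i j
  simp

lemma algHom_comp_factoredOp_affMat (S : JetAlgebra ℝ (Fin n) R) (e : R →ₐ[ℝ] ℝ) {u : Fin n → R}
    (hu : IsUnit (C.affMat u).det) (ρ : Fin n → R) :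
    e ∘ S.factoredOp (C.affMat u) φ⁻¹ ρ = (C.monge φ (e ∘ u))⁻¹ *ᵥ (e ∘ S.D ∘ ρ) -
      ((C.monge φ (e ∘ u))⁻¹ * (linMat C.psi (e ∘ S.D ∘ u))ᵀ * (C.psiMat (e ∘ u))⁻¹ᵀ) *ᵥ
        (e ∘ ρ) := by
  have hsub : ∀ v w : Fin n → R, e ∘ (v - w) = e ∘ v - e ∘ w := fun v w =>
    funext fun i => map_sub e (v i) (w i)
  have hlin : ∀ X, (linMat C.psi X).map e = linMat C.psi (e ∘ X) :=
    map_linMat (e : R →ₗ[ℝ] ℝ)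
  rw [S.factoredOp_eq hu, hsub, algHom_comp_mulVec, algHom_comp_mulVec, derivation_affMat]
  simp only [Matrix.map_mul, Matrix.transpose_map, map_nonsing_inv_algHom e hu, map_affMat,
    map_map_algHom, hlin, monge_inv]

end AffineMatrix

section Operator

variable {Ω : Set (Jet n)} {l : ℕ}

lemma isUnit_det_affMat (hreg : ∀ q ∈ Ω, q.2 l ∈ C.regular) :
    IsUnit (C.affMat (coordAlg Ω l)).det := by
  refine isUnit_of_forall_ne_zero fun q => ?_
  have hdet : evalAt q (C.affMat (coordAlg Ω l)).det = (C.psiMat (q.1.2 l)).det :=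
    (AlgHom.map_det _ _).trans (congrArg Matrix.det (map_affMat (evalAt q) _))
  exact fun h => hreg q q.2 (hdet.symm.trans h)

lemma IsMonge.extends_innerOp (hC : C.IsMonge φ) (hΩ : IsOpen Ω)
    (hreg : ∀ q ∈ Ω, q.2 l ∈ C.regular) {π : Fin n → Jet n → ℝ} {ρ : Fin n → diffAlg Ω}
    (hπ : ∀ j, Extends (π j) (ρ j)) (i : Fin n) :
    Extends (innerOp (C.monge φ) (fun q => q.2 l) (fun q => q.2 (l + 1)) π i)
      ((jetAlg hΩ).factoredOp (C.affMat (coordAlg Ω l)) φ⁻¹ ρ i) := fun q => by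
  have heval := congrFun (C.algHom_comp_factoredOp_affMat (φ := φ) (jetAlg hΩ) (evalAt q)
    (isUnit_det_affMat hreg) ρ) i
  have hπq : evalAt q ∘ ρ = fun j => π j q := funext fun j => (hπ j q).symm
  have hDπq : evalAt q ∘ (jetAlg hΩ).D ∘ ρ = fun j => totalD (π j) q :=
    funext fun j => ((hπ j).totalD hΩ q).symm
  have hDu : evalAt q ∘ (jetAlg hΩ).D ∘ coordAlg Ω l = q.1.2 (l + 1) :=
    funext fun j => congrArg (evalAt q) (D_coordAlg hΩ l j)
  rw [hπq, hDπq, hDu] at heval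
  refine Eq.trans ?_ heval.symm
  simp only [innerOp, hC.sum_upperC (hreg q q.2), neg_mul, ← sub_eq_add_neg]
  exact Finset.sum_sub_distrib _ _

lemma IsMonge.extends_bracket (hC : C.IsMonge φ) (hΩ : IsOpen Ω)
    (hreg : ∀ q ∈ Ω, q.2 0 ∈ C.regular) {P Q : Jet n → ℝ} {g h : diffAlg Ω}
    (hP : Extends P g) (hQ : Extends Q h) :
    Extends (bracket (thirdOrderOp (C.monge φ)) P Q)
      ((jetAlg hΩ).factoredBracket (C.affMat (coordAlg Ω 0)) φ⁻¹ g h) := fun q => by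
  have hop : ∀ i, Extends (thirdOrderOp (C.monge φ) (fun j => varD j Q) i) _ := fun i =>
    (hC.extends_innerOp hΩ hreg (fun j => (hQ.varD hΩ j).totalD hΩ) i).totalD hΩ
  simp only [bracket, hP.varD hΩ _ q, hop _ q]
  refine Eq.trans ?_ (algHom_dotProduct (evalAt q) _ _).symm
  rfl

lemma monge_transpose (hφ : φᵀ = φ) (u : Fin n → ℝ) : (C.monge φ u)ᵀ = C.monge φ u := by
  rw [monge, Matrix.transpose_mul, Matrix.transpose_mul, Matrix.transpose_transpose, hφ,
    Matrix.mul_assoc]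

lemma det_monge (C : LineCongruence n) (φ : Matrix (Fin n) (Fin n) ℝ) (u : Fin n → ℝ) :
    (C.monge φ u).det = (C.psiMat u).det ^ 2 * φ.det := by
  rw [monge, Matrix.det_mul, Matrix.det_mul, Matrix.det_transpose]
  ring

lemma isOpen_setOf_coord_mem_regular (C : LineCongruence n) (l : ℕ) :
    IsOpen {q : Jet n | q.2 l ∈ C.regular} :=
  C.isOpen_regular.preimage ((continuous_apply l).comp continuous_snd)

lemma IsMonge.isCyclic_affMat (hC : C.IsMonge φ) (u : Fin n → diffAlg Ω) :
    IsCyclic C.psi (φ.map (algebraMap ℝ (diffAlg Ω)) * C.affMat u) :=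
  isCyclic_of_evalAt fun q => by
    rw [Matrix.map_mul, map_map_algHom, map_affMat]
    exact hC.cyclic _

theorem IsMonge.isHamiltonianOp (hC : C.IsMonge φ) (hΩ : IsOpen Ω)
    (hreg : ∀ q ∈ Ω, q.2 0 ∈ C.regular) : IsHamiltonianOp Ω (thirdOrderOp (C.monge φ)) := by
  have hK : φ⁻¹ᵀ = φ⁻¹ := by rw [Matrix.transpose_nonsing_inv, hC.symm]
  have extends_bracket := @IsMonge.extends_bracket _ _ _ _ hC hΩ hreg
  refine ⟨fun P Q hP hQ => ?_, fun P Q T hP hQ hT => ?_⟩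
  all_goals
    obtain ⟨g, hg⟩ := isDiffFun_iff_exists_extends.1 hP
    obtain ⟨h, hh⟩ := isDiffFun_iff_exists_extends.1 hQ
  · refine (((extends_bracket hg hh).add
      (extends_bracket hh hg)).isTotalDerivative_iff hΩ).2 ?_
    exact (jetAlg hΩ).integral_factoredBracket_add hK g h
  · obtain ⟨k, hk⟩ := isDiffFun_iff_exists_extends.1 hT
    refine ((((extends_bracket (extends_bracket hg hh) hk).add
      (extends_bracket (extends_bracket hh hk) hg)).add
      (extends_bracket (extends_bracket hk hg) hh)).isTotalDerivative_iff hΩ).2 ?_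
    refine JetAlgebra.integral_factoredBracket_jacobi hK
      (Matrix.mul_nonsing_inv φ hC.det_ne_zero.isUnit) (isUnit_det_affMat hreg) hC.skew
      (fun X => ?_) (fun x y z => ?_) g h k
    · rw [derivation_affMat, evolve_coordAlg]
    · simpa only [Matrix.mulVec_mulVec] using hC.isCyclic_affMat (coordAlg Ω 0) x y z

theorem IsMonge.isThirdOrderHamiltonian (hC : C.IsMonge φ) :
    IsThirdOrderHamiltonian C.regular (C.monge φ) := by
  refine ⟨fun u hu => ⟨monge_transpose hC.symm u, ?_⟩,
    hC.isHamiltonianOp (C.isOpen_setOf_coord_mem_regular 0) fun _ hq => hq⟩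
  rw [det_monge]
  exact mul_ne_zero (pow_ne_zero 2 hu) hC.det_ne_zero

end Operator

end LineCongruence

namespace LineCongruence

variable {n : ℕ}

/-- The conditions on a congruence under which the system `u_t = (V(u))_x` that it defines is
Hamiltonian with respect to the operator given by its Monge metric. -/
structure IsMongeSystem (C : LineCongruence n) (φ : Matrix (Fin n) (Fin n) ℝ) : Prop
    extends C.IsMonge φ where
  theta_cyclic : IsCyclic C.psi (φ * C.theta)
  xi_skew : ∀ x y : Fin n → ℝ, (C.omega *ᵥ x) ⬝ᵥ ((φ * C.theta) *ᵥ y) -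
    (C.omega *ᵥ y) ⬝ᵥ ((φ * C.theta) *ᵥ x) = (linMat C.psi y *ᵥ x) ⬝ᵥ (φ *ᵥ C.xi)

section Energy

variable {𝕜 ι R : Type*} [CommRing 𝕜] [Fintype ι] [CommRing R] [Algebra 𝕜 R]

/-- The Hamiltonian density of a Monge system, multiplied by `-6`, in terms of the potentials `b`,
their derivatives `u` and the independent variable `x`; here `Θ = φ θ` and `Ξ = φ ξ`.
The coefficients are such that the variational derivative is `6 (ψ(u) + ω)ᵀ (Θ b + x Ξ)`. -/
def energy (ψ : ι → Matrix ι ι 𝕜) (ω Θ : Matrix ι ι R) (Ξ b u : ι → R) (x : R) : R :=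
  2 • ((linMat ψ u *ᵥ b) ⬝ᵥ (Θ *ᵥ b)) + 3 • (x * ((linMat ψ u *ᵥ b) ⬝ᵥ Ξ)) +
    3 • ((ω *ᵥ b) ⬝ᵥ (Θ *ᵥ b)) + 6 • (x * ((ω *ᵥ b) ⬝ᵥ Ξ))

lemma derivation_energy {δ : Derivation 𝕜 R R} {ω Θ : Matrix ι ι R} {Ξ : ι → R}
    (hω : ω.map δ = 0) (hΘ : Θ.map δ = 0) (hΞ : δ ∘ Ξ = 0) (ψ : ι → Matrix ι ι 𝕜) (b u : ι → R)
    (x : R) :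
    δ (energy ψ ω Θ Ξ b u x) =
      2 • ((linMat ψ (δ ∘ u) *ᵥ b + linMat ψ u *ᵥ (δ ∘ b)) ⬝ᵥ (Θ *ᵥ b) +
        (linMat ψ u *ᵥ b) ⬝ᵥ (Θ *ᵥ (δ ∘ b))) +
      3 • (δ x * ((linMat ψ u *ᵥ b) ⬝ᵥ Ξ) +
        x * ((linMat ψ (δ ∘ u) *ᵥ b + linMat ψ u *ᵥ (δ ∘ b)) ⬝ᵥ Ξ)) +
      3 • ((ω *ᵥ (δ ∘ b)) ⬝ᵥ (Θ *ᵥ b) + (ω *ᵥ b) ⬝ᵥ (Θ *ᵥ (δ ∘ b))) +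
      6 • (δ x * ((ω *ᵥ b) ⬝ᵥ Ξ) + x * ((ω *ᵥ (δ ∘ b)) ⬝ᵥ Ξ)) := by
  simp only [energy, map_add, map_nsmul, Derivation.leibniz, smul_eq_mul, derivation_dotProduct,
    derivation_mulVec, derivation_linMat, hω, hΘ, hΞ, Matrix.zero_mulVec, zero_add,
    dotProduct_zero]
  ring

lemma derivation_energy_of_comp_velocity_eq_zero {δ : Derivation 𝕜 R R} {ω Θ : Matrix ι ι R}
    {Ξ u : ι → R} {x : R} (hω : ω.map δ = 0) (hΘ : Θ.map δ = 0) (hΞ : δ ∘ Ξ = 0) (hu : δ ∘ u = 0)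
    (hx : δ x = 0) (ψ : ι → Matrix ι ι 𝕜) (b : ι → R) :
    δ (energy ψ ω Θ Ξ b u x) =
      2 • ((linMat ψ u *ᵥ (δ ∘ b)) ⬝ᵥ (Θ *ᵥ b) + (linMat ψ u *ᵥ b) ⬝ᵥ (Θ *ᵥ (δ ∘ b))) +
        3 • (x * ((linMat ψ u *ᵥ (δ ∘ b)) ⬝ᵥ Ξ)) +
        3 • ((ω *ᵥ (δ ∘ b)) ⬝ᵥ (Θ *ᵥ b) + (ω *ᵥ b) ⬝ᵥ (Θ *ᵥ (δ ∘ b))) +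
        6 • (x * ((ω *ᵥ (δ ∘ b)) ⬝ᵥ Ξ)) := by
  simp [derivation_energy hω hΘ hΞ, hu, hx, linMat_zero]

lemma derivation_energy_of_comp_potential_eq_zero {δ : Derivation 𝕜 R R} {ω Θ : Matrix ι ι R}
    {Ξ b : ι → R} {x : R} (hω : ω.map δ = 0) (hΘ : Θ.map δ = 0) (hΞ : δ ∘ Ξ = 0) (hb : δ ∘ b = 0)
    (hx : δ x = 0) (ψ : ι → Matrix ι ι 𝕜) (u : ι → R) :
    δ (energy ψ ω Θ Ξ b u x) = 2 • ((linMat ψ (δ ∘ u) *ᵥ b) ⬝ᵥ (Θ *ᵥ b)) +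
      3 • (x * ((linMat ψ (δ ∘ u) *ᵥ b) ⬝ᵥ Ξ)) := by
  simp [derivation_energy hω hΘ hΞ, hb, hx]

variable [DecidableEq ι] {S : JetAlgebra 𝕜 ι R} {ψ : ι → Matrix ι ι 𝕜} {ω Θ : Matrix ι ι R}
  {Ξ b u : ι → R} {x : R}

lemma varDeriv_energy (hψ : ∀ γ, (ψ γ)ᵀ = -ψ γ)
    (hω : ∀ δ : Derivation 𝕜 R R, ω.map δ = 0) (hΘ : ∀ δ : Derivation 𝕜 R R, Θ.map δ = 0)
    (hΞ : ∀ δ : Derivation 𝕜 R R, δ ∘ Ξ = 0)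
    (db : ∀ k j, S.d k j ∘ b = if k = 0 then Pi.single j 1 else 0)
    (du : ∀ k j, S.d k j ∘ u = if k = 1 then Pi.single j 1 else 0)
    (dx : ∀ k j, S.d k j x = 0) (Db : S.D ∘ b = u) (Dx : S.D x = 1) (cyclic : IsCyclic ψ Θ)
    (skew : ∀ X Y : ι → R, (ω *ᵥ X) ⬝ᵥ (Θ *ᵥ Y) - (ω *ᵥ Y) ⬝ᵥ (Θ *ᵥ X) =
      (linMat ψ Y *ᵥ X) ⬝ᵥ Ξ) :
    S.varDeriv (energy ψ ω Θ Ξ b u x) = (6 : 𝕜) • ((linMat ψ u + ω)ᵀ *ᵥ (Θ *ᵥ b + x • Ξ)) := by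
  have order : S.HasOrderLT 2 (energy ψ ω Θ Ξ b u x) := fun k hk i => by
    rw [derivation_energy (hω _) (hΘ _) (hΞ _), db, du, if_neg (by omega), if_neg (by omega), dx]
    simp [linMat_zero]
  funext j
  obtain ⟨e, he⟩ : ∃ e : ι → R, Pi.single j 1 = e := ⟨_, rfl⟩
  have De : S.D ∘ e = 0 := funext fun i => by
    subst he
    obtain rfl | hi := eq_or_ne i j <;> simp [*]
  have dual : ((linMat ψ u + ω)ᵀ *ᵥ (Θ *ᵥ b + x • Ξ)) j =
      ((linMat ψ u + ω) *ᵥ e) ⬝ᵥ (Θ *ᵥ b + x • Ξ) := by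
    rw [← he, Matrix.mulVec_single_one]
    rfl
  have d_zero := derivation_energy_of_comp_velocity_eq_zero (hω _) (hΘ _) (hΞ _)
    ((du 0 j).trans (if_neg zero_ne_one)) (dx 0 j) ψ b
  have d_one := derivation_energy_of_comp_potential_eq_zero (hω _) (hΘ _) (hΞ _)
    ((db 1 j).trans (if_neg one_ne_zero)) (dx 1 j) ψ u
  rw [db, if_pos rfl, he] at d_zero
  rw [du, if_pos rfl, he] at d_one
  have D_d_one : S.D (S.d 1 j (energy ψ ω Θ Ξ b u x)) =
      2 • ((linMat ψ e *ᵥ u) ⬝ᵥ (Θ *ᵥ b) + (linMat ψ e *ᵥ b) ⬝ᵥ (Θ *ᵥ u)) +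
        3 • (x * ((linMat ψ e *ᵥ u) ⬝ᵥ Ξ) + (linMat ψ e *ᵥ b) ⬝ᵥ Ξ) := by
    simp only [d_one, map_add, map_nsmul, Derivation.leibniz, smul_eq_mul, derivation_dotProduct,
      derivation_mulVec, derivation_linMat, De, Db, Dx, hΘ, hΞ, linMat_zero, Matrix.zero_mulVec,
      zero_add, add_zero, dotProduct_zero, mul_one]
  have cyclic_e := cyclic b e u
  have skew_e := skew e b
  rw [linMat_mulVec_comm hψ b u, dotProduct_neg, dotProduct_comm _ (linMat ψ u *ᵥ e),
    dotProduct_comm _ (linMat ψ u *ᵥ b), dotProduct_comm _ (linMat ψ e *ᵥ b)] at cyclic_e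
  rw [linMat_mulVec_comm hψ b e, neg_dotProduct] at skew_e
  rw [JetAlgebra.varDeriv_eq_of_hasOrderLT_two _ order, d_zero, D_d_one, Pi.smul_apply,
    Algebra.smul_def (6 : 𝕜), map_ofNat, dual, linMat_mulVec_comm hψ e u]
  simp only [Matrix.add_mulVec, add_dotProduct, dotProduct_add, dotProduct_smul, neg_dotProduct,
    smul_eq_mul]
  linear_combination -2 * cyclic_e - 3 * skew_e

end Energy

variable {C : LineCongruence n} {φ : Matrix (Fin n) (Fin n) ℝ} {Ω : Set (Jet n)} {l : ℕ}

lemma IsMongeSystem.isCyclic_map_theta (hC : C.IsMongeSystem φ) :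
    IsCyclic C.psi ((φ * C.theta).map (algebraMap ℝ (diffAlg Ω))) :=
  isCyclic_of_evalAt fun q => by
    rw [map_map_algHom]
    exact hC.theta_cyclic

lemma IsMongeSystem.xi_skew_diffAlg (hC : C.IsMongeSystem φ) (x y : Fin n → diffAlg Ω) :
    (C.omega.map (algebraMap ℝ _) *ᵥ x) ⬝ᵥ ((φ * C.theta).map (algebraMap ℝ _) *ᵥ y) -
      (C.omega.map (algebraMap ℝ _) *ᵥ y) ⬝ᵥ ((φ * C.theta).map (algebraMap ℝ _) *ᵥ x) =
      (linMat C.psi y *ᵥ x) ⬝ᵥ (algebraMap ℝ _ ∘ (φ *ᵥ C.xi)) :=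
  diffAlg_ext fun q => by
    have hlin : ∀ X, (linMat C.psi X).map (evalAt q) = linMat C.psi (evalAt q ∘ X) :=
      map_linMat (evalAt q : diffAlg Ω →ₗ[ℝ] ℝ)
    simp only [map_sub, algHom_dotProduct, algHom_comp_mulVec, map_map_algHom, hlin,
      algHom_comp_algebraMap_comp]
    exact hC.xi_skew _ _

section System

variable (hΩ : IsOpen Ω)

lemma d_comp_coordAlg (k l : ℕ) (j : Fin n) :
    (jetAlg hΩ).d k j ∘ coordAlg Ω l = if l = k then Pi.single j 1 else 0 := by
  funext i
  rw [Function.comp_apply, d_coordAlg, ite_and]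
  split_ifs <;> simp_all

lemma D_comp_coordAlg (l : ℕ) : (jetAlg hΩ).D ∘ coordAlg Ω l = coordAlg Ω (l + 1) :=
  funext (D_coordAlg hΩ l)

variable (C φ Ω) in
/-- The Hamiltonian density of a Monge system as a differential function of the potentials. -/
def hamiltonian : diffAlg Ω :=
  (-(1 / 6) : ℝ) • energy C.psi (C.omega.map (algebraMap ℝ _))
    ((φ * C.theta).map (algebraMap ℝ _)) (algebraMap ℝ _ ∘ (φ *ᵥ C.xi)) (coordAlg Ω 0)
    (coordAlg Ω 1) (xAlg Ω)

variable (C φ Ω) in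
/-- The covector `φ (θ b + x ξ)`, a primitive of `φ Z`. -/
def momentum : Fin n → diffAlg Ω :=
  (φ * C.theta).map (algebraMap ℝ _) *ᵥ coordAlg Ω 0 + xAlg Ω • (algebraMap ℝ _ ∘ (φ *ᵥ C.xi))

lemma IsMongeSystem.varDeriv_hamiltonian (hC : C.IsMongeSystem φ) :
    (jetAlg hΩ).varDeriv (C.hamiltonian φ Ω) =
      -((C.affMat (coordAlg Ω 1))ᵀ *ᵥ C.momentum φ Ω) := by
  rw [hamiltonian, JetAlgebra.varDeriv_smul, varDeriv_energy hC.skew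
    (fun δ => derivation_map_algebraMap δ _) (fun δ => derivation_map_algebraMap δ _)
    (Ξ := algebraMap ℝ _ ∘ (φ *ᵥ C.xi)) (u := coordAlg Ω 1)
    (fun δ => funext fun i => δ.map_algebraMap _) (fun k j => ?_) (fun k j => ?_) (d_xAlg hΩ)
    (D_comp_coordAlg hΩ 0) (D_xAlg hΩ) hC.isCyclic_map_theta hC.xi_skew_diffAlg, smul_smul]
  · rw [show (-(1 / 6) * 6 : ℝ) = -1 by norm_num]
    exact neg_one_smul ℝ (_ : Fin n → diffAlg Ω)
  · simp only [d_comp_coordAlg, eq_comm]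
  · simp only [d_comp_coordAlg, eq_comm]

lemma D_comp_momentum : (jetAlg hΩ).D ∘ C.momentum φ Ω = φ.map (algebraMap ℝ _) *ᵥ
    (C.theta.map (algebraMap ℝ _) *ᵥ coordAlg Ω 1 + algebraMap ℝ _ ∘ C.xi) := by
  have hξ : algebraMap ℝ (diffAlg Ω) ∘ (φ *ᵥ C.xi) =
      φ.map (algebraMap ℝ _) *ᵥ (algebraMap ℝ _ ∘ C.xi) :=
    funext (RingHom.map_mulVec (algebraMap ℝ (diffAlg Ω)) φ C.xi)
  have hD : (jetAlg hΩ).D ∘ C.momentum φ Ω =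
      (jetAlg hΩ).D ∘ ((φ * C.theta).map (algebraMap ℝ _) *ᵥ coordAlg Ω 0) +
        algebraMap ℝ _ ∘ (φ *ᵥ C.xi) := by
    funext i
    simp [momentum, D_xAlg]
  rw [hD, derivation_const_mulVec, D_comp_coordAlg, Matrix.map_mul, ← Matrix.mulVec_mulVec, hξ,
    Matrix.mulVec_add]

lemma extends_flux (hreg : ∀ q ∈ Ω, q.2 l ∈ C.regular) (i : Fin n) :
    Extends (fun q => C.flux (q.2 l) i) (((C.affMat (coordAlg Ω l))⁻¹ *ᵥ
      (C.theta.map (algebraMap ℝ _) *ᵥ coordAlg Ω l + algebraMap ℝ _ ∘ C.xi)) i) := fun q => by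
  have hadd : ∀ v w : Fin n → diffAlg Ω, evalAt q ∘ (v + w) = evalAt q ∘ v + evalAt q ∘ w :=
    fun v w => funext fun i => map_add (evalAt q) (v i) (w i)
  refine (congrFun (?_ : evalAt q ∘ _ = C.flux (q.1.2 l)) i).symm
  rw [algHom_comp_mulVec, map_nonsing_inv_algHom _ (isUnit_det_affMat hreg), map_affMat, hadd,
    algHom_comp_mulVec, map_map_algHom, algHom_comp_algebraMap_comp]
  rfl

end System

theorem IsMongeSystem.isHamiltonianSystem (hC : C.IsMongeSystem φ) :
    IsHamiltonianSystem C.regular (C.monge φ) C.flux := by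
  set Ω := {q : Jet n | q.2 1 ∈ C.regular}
  have hΩ : IsOpen Ω := C.isOpen_setOf_coord_mem_regular 1
  have hreg : ∀ q ∈ Ω, q.2 1 ∈ C.regular := fun _ hq => hq
  have hH := extends_extendByZero (C.hamiltonian φ Ω)
  have hπ : ∀ j, Extends (fun r => -varD j (extendByZero (C.hamiltonian φ Ω)) r)
      (((C.affMat (coordAlg Ω 1))ᵀ *ᵥ C.momentum φ Ω) j) := fun j q => by
    refine (congrArg Neg.neg (hH.varD hΩ j q)).trans ?_
    rw [hC.varDeriv_hamiltonian hΩ]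
    exact neg_neg _
  have hop : (jetAlg hΩ).factoredOp (C.affMat (coordAlg Ω 1)) φ⁻¹
      ((C.affMat (coordAlg Ω 1))ᵀ *ᵥ C.momentum φ Ω) = (C.affMat (coordAlg Ω 1))⁻¹ *ᵥ
        (C.theta.map (algebraMap ℝ _) *ᵥ coordAlg Ω 1 + algebraMap ℝ _ ∘ C.xi) := by
    rw [JetAlgebra.factoredOp_transpose_mulVec (isUnit_det_affMat hreg), D_comp_momentum,
      Matrix.mulVec_mulVec _ _ (φ.map _), ← Matrix.map_mul,
      Matrix.nonsing_inv_mul φ hC.det_ne_zero.isUnit, Matrix.map_one _ (map_zero _) (map_one _),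
      Matrix.one_mulVec]
  refine ⟨extendByZero (C.hamiltonian φ Ω), hH.isDiffFun, fun q hq i => ?_⟩
  exact (((extends_flux hreg i).totalD hΩ).eq_iff
    ((hC.extends_innerOp hΩ hreg hπ i).totalD hΩ)).1 (by rw [hop]) q hq

end LineCongruence

namespace LineCongruence

variable {n : ℕ} {C : LineCongruence n}

lemma sum_mul_plucker (A : Matrix (Fin n) (Fin n) ℝ) (u v : Fin n → ℝ) :
    ∑ k, ∑ m, A k m * (u m * v k - u k * v m) = v ⬝ᵥ (A *ᵥ u) - u ⬝ᵥ (A *ᵥ v) := by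
  simp only [dotProduct, Matrix.mulVec, mul_sub, Finset.sum_sub_distrib, Finset.mul_sum]
  congr 1 <;> exact Finset.sum_congr rfl fun k _ => Finset.sum_congr rfl fun m _ => by ring

lemma swap_holds_iff {u v : Fin n → ℝ} : C.swap.Holds u v ↔ C.Holds v u :=
  forall_congr' fun γ => by
    simp only [swap, sum_mul_plucker, Pi.neg_apply]
    constructor <;> intro h <;> linarith

lemma holds_iff_psiMat_mulVec (hC : ∀ γ, (C.psi γ)ᵀ = -C.psi γ) {u v : Fin n → ℝ} :
    C.Holds u v ↔ C.psiMat u *ᵥ v = C.theta *ᵥ u + C.xi := by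
  rw [funext_iff]
  refine forall_congr' fun γ => ?_
  have skew : u ⬝ᵥ (C.psi γ *ᵥ v) = -(v ⬝ᵥ (C.psi γ *ᵥ u)) := by
    rw [Matrix.dotProduct_mulVec, ← Matrix.mulVec_transpose, hC, Matrix.neg_mulVec, neg_dotProduct,
      dotProduct_comm]
  have row : (C.psiMat u *ᵥ v) γ = v ⬝ᵥ (C.psi γ *ᵥ u) + (C.omega *ᵥ v) γ := by
    rw [dotProduct_comm]
    simp only [psiMat, Matrix.mulVec, dotProduct, Matrix.of_apply, add_mul, Finset.sum_add_distrib]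
  rw [sum_mul_plucker, skew, row, Pi.add_apply]
  change 1 / 2 * _ + (C.omega *ᵥ v) γ - (C.theta *ᵥ u) γ - C.xi γ = 0 ↔ _
  constructor <;> intro h <;> linarith

lemma holds_iff_eq_flux (hC : ∀ γ, (C.psi γ)ᵀ = -C.psi γ) {u : Fin n → ℝ}
    (hu : u ∈ C.regular) (v : Fin n → ℝ) : C.Holds u v ↔ v = C.flux u := by
  have hA : IsUnit (C.psiMat u).det := isUnit_iff_ne_zero.2 hu
  rw [holds_iff_psiMat_mulVec hC, flux]
  constructor <;> intro h
  · rw [← h, Matrix.mulVec_mulVec, Matrix.nonsing_inv_mul _ hA, Matrix.one_mulVec]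
  · rw [h, Matrix.mulVec_mulVec, Matrix.mul_nonsing_inv _ hA, Matrix.one_mulVec]

lemma IsMongeSystem.swap {φ : Matrix (Fin n) (Fin n) ℝ} (hC : C.IsMongeSystem φ) :
    C.swap.IsMongeSystem φ where
  symm := hC.symm
  det_ne_zero := hC.det_ne_zero
  skew := hC.skew
  cyclic u x y z := by
    have cyclic_u := hC.cyclic u x y z
    have cyclic_zero := hC.cyclic 0 x y z
    have cyclic_theta := hC.theta_cyclic x y z
    simp only [LineCongruence.swap, psiMat_eq, linMat_zero, zero_add, Matrix.mul_add,
      Matrix.add_mulVec, add_dotProduct] at cyclic_u cyclic_zero cyclic_theta ⊢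
    linear_combination cyclic_u - cyclic_zero + cyclic_theta
  theta_cyclic := by
    have cyclic_zero := hC.cyclic 0
    rwa [psiMat_eq, linMat_zero, zero_add] at cyclic_zero
  xi_skew x y := by
    have comm : ∀ v w : Fin n → ℝ, (C.theta *ᵥ v) ⬝ᵥ ((φ * C.omega) *ᵥ w) =
        (C.omega *ᵥ w) ⬝ᵥ ((φ * C.theta) *ᵥ v) := fun v w => by
      rw [← Matrix.mulVec_mulVec, ← Matrix.mulVec_mulVec, Matrix.dotProduct_mulVec,
        ← Matrix.mulVec_transpose, hC.symm, dotProduct_comm]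
    have skew := hC.xi_skew x y
    simp only [LineCongruence.swap, Matrix.mulVec_neg, dotProduct_neg, comm]
    linarith

end LineCongruence

lemma dense_setOf_affine_ne_zero {ι : Type*} [Fintype ι] {a : ι → ℝ} {c : ℝ}
    (h : a = 0 → c ≠ 0) : Dense {u : ι → ℝ | a ⬝ᵥ u + c ≠ 0} := by
  classical
  by_cases ha : a = 0
  · simp [ha, h ha]
  obtain ⟨i, hi⟩ := Function.ne_iff.1 ha
  have surjective : Function.Surjective (dotProductBilin ℝ ℝ a) := fun y =>
    ⟨Pi.single i (y / a i), by
      simp only [dotProductBilin_apply_apply, dotProduct_single]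
      exact mul_div_cancel₀ y hi⟩
  have isOpenMap := (dotProductBilin ℝ ℝ a).isOpenMap_of_finiteDimensional surjective
  refine ((dense_compl_singleton (-c)).preimage isOpenMap).mono fun u hu h0 => ?_
  exact hu (eq_neg_of_add_eq_zero_left h0)

section Nondegeneracy

variable {η : Matrix (Fin 3) (Fin 3) ℝ}

lemma exists_inv_entries (hsymm : η.IsSymm) (hdet : η.det ≠ 0) :
    ∃ a b c d e f D : ℝ, D ≠ 0 ∧ D = a * (d * f - e * e) - b * (b * f - c * e) +
      c * (b * e - c * d) ∧ η⁻¹ = !![a, b, c; b, d, e; c, e, f] ∧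
      η = D⁻¹ • !![d * f - e * e, c * e - b * f, b * e - c * d;
        c * e - b * f, a * f - c * c, b * c - a * e;
        b * e - c * d, b * c - a * e, a * d - b * b] := by
  have hs : ∀ i j, η⁻¹ i j = η⁻¹ j i := fun i j => hsymm.inv.apply j i
  have entries : η⁻¹ = !![η⁻¹ 0 0, η⁻¹ 0 1, η⁻¹ 0 2; η⁻¹ 0 1, η⁻¹ 1 1, η⁻¹ 1 2;
      η⁻¹ 0 2, η⁻¹ 1 2, η⁻¹ 2 2] := by
    ext i j
    fin_cases i <;> fin_cases j <;> first | rfl | exact hs _ _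
  refine ⟨_, _, _, _, _, _, η⁻¹.det, ?_, ?_, entries, ?_⟩
  · rw [Matrix.det_nonsing_inv, Ring.inverse_eq_inv']
    exact inv_ne_zero hdet
  · rw [Matrix.det_fin_three, hs 1 0, hs 2 0, hs 2 1]
    ring
  · have inv_inv : η = η⁻¹.det⁻¹ • η⁻¹.adjugate := by
      conv_lhs => rw [← Matrix.nonsing_inv_nonsing_inv η hdet.isUnit, Matrix.inv_def η⁻¹,
        Ring.inverse_eq_inv']
    refine inv_inv.trans ?_
    rw [Matrix.adjugate_fin_three]
    congr 1
    ext i j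
    fin_cases i <;> fin_cases j <;> simp [hs 1 0, hs 2 0, hs 2 1] <;> ring

lemma det_phi (hsymm : η.IsSymm) : (phi η).det = η⁻¹.det ^ 2 := by
  have hs : ∀ i j, η⁻¹ i j = η⁻¹ j i := fun i j => hsymm.inv.apply j i
  rw [Matrix.det_fin_three, Matrix.det_fin_three, hs 1 0, hs 2 0, hs 2 1]
  simp only [phi, Matrix.of_apply, Matrix.cons_val]
  ring

lemma det_phi_ne_zero (hsymm : η.IsSymm) (hdet : η.det ≠ 0) : (phi η).det ≠ 0 := by
  rw [det_phi hsymm, Matrix.det_nonsing_inv, Ring.inverse_eq_inv']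
  exact pow_ne_zero 2 (inv_ne_zero hdet)

lemma phi_transpose (η : Matrix (Fin 3) (Fin 3) ℝ) : (phi η)ᵀ = phi η := by
  ext i j
  fin_cases i <;> fin_cases j <;> rfl

lemma wdvvCongruence_psi_transpose (η : Matrix (Fin 3) (Fin 3) ℝ) (γ : Fin 3) :
    ((wdvvCongruence η).psi γ)ᵀ = -(wdvvCongruence η).psi γ := by
  ext i k
  fin_cases γ <;> fin_cases i <;> fin_cases k <;> simp [wdvvCongruence]

/-- The cyclic sum is alternating in its three arguments, hence a multiple of their determinant. -/
lemma isCyclic_wdvvCongruence {N : Matrix (Fin 3) (Fin 3) ℝ}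
    (h : N 2 0 * η⁻¹ 2 2 - N 2 1 * η⁻¹ 1 2 + N 2 2 * η⁻¹ 1 1 = 0) :
    IsCyclic (wdvvCongruence η).psi N := fun x y z => by
  simp only [linMat, wdvvCongruence, dotProduct, Matrix.mulVec, Fin.sum_univ_three,
    Matrix.of_apply, Matrix.cons_val, Matrix.zero_apply, smul_eq_mul]
  linear_combination -(x 0 * (y 1 * z 2 - y 2 * z 1) - x 1 * (y 0 * z 2 - y 2 * z 0) +
    x 2 * (y 0 * z 1 - y 1 * z 0)) * h

lemma isMongeSystem_wdvvCongruence (hsymm : η.IsSymm) (hdet : η.det ≠ 0) :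
    (wdvvCongruence η).IsMongeSystem (phi η) := by
  obtain ⟨a, b, c, d, e, f, D, hD, hDeq, hinv, hη⟩ := exists_inv_entries hsymm hdet
  have entry := fun i j => congrFun (congrFun hη i) j
  refine ⟨⟨phi_transpose η, det_phi_ne_zero hsymm hdet, wdvvCongruence_psi_transpose η,
    fun u => isCyclic_wdvvCongruence ?_⟩, isCyclic_wdvvCongruence ?_, fun x y => ?_⟩
  all_goals
    simp only [Matrix.mul_apply, dotProduct, Matrix.mulVec, linMat, Fin.sum_univ_three, phi,
      LineCongruence.psiMat, wdvvCongruence, hinv, entry, Matrix.of_apply, Matrix.cons_val,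
      Matrix.smul_apply, Matrix.zero_apply, smul_eq_mul]
    field_simp
    rw [hDeq]
    ring

lemma isMongeSystem_chosenCongruence (hsymm : η.IsSymm) (hdet : η.det ≠ 0) (p : Fin 3) :
    (chosenCongruence η p).IsMongeSystem (phi η) := by
  unfold chosenCongruence
  split_ifs
  exacts [isMongeSystem_wdvvCongruence hsymm hdet, (isMongeSystem_wdvvCongruence hsymm hdet).swap]

lemma det_psiMat_wdvvCongruence (η : Matrix (Fin 3) (Fin 3) ℝ) (u : Fin 3 → ℝ) :
    ((wdvvCongruence η).psiMat u).det = ![η⁻¹ 1 2, η⁻¹ 2 2, 0] ⬝ᵥ u + η⁻¹ 0 2 * η 1 1 := by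
  rw [Matrix.det_fin_three]
  simp [LineCongruence.psiMat, wdvvCongruence, Fin.sum_univ_three, dotProduct]

lemma det_psiMat_swap_wdvvCongruence (η : Matrix (Fin 3) (Fin 3) ℝ) (u : Fin 3 → ℝ) :
    ((wdvvCongruence η).swap.psiMat u).det =
      ![0, -η⁻¹ 1 1, -η⁻¹ 1 2] ⬝ᵥ u + -(η⁻¹ 0 1 * η 2 2) := by
  rw [Matrix.det_fin_three]
  simp [LineCongruence.psiMat, LineCongruence.swap, wdvvCongruence, Fin.sum_univ_three, dotProduct]

lemma dense_regular_chosenCongruence (hsymm : η.IsSymm) (hdet : η.det ≠ 0) (p : Fin 3) :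
    Dense (chosenCongruence η p).regular := by
  obtain ⟨a, b, c, d, e, f, D, hD, hDeq, hinv, hη⟩ := exists_inv_entries hsymm hdet
  unfold chosenCongruence LineCongruence.regular
  split_ifs
  · simp only [det_psiMat_wdvvCongruence]
    refine dense_setOf_affine_ne_zero fun linear => ?_
    obtain rfl : e = 0 := by simpa [hinv] using congrFun linear 0
    obtain rfl : f = 0 := by simpa [hinv] using congrFun linear 1
    have entry : η 1 1 = D⁻¹ * (a * 0 - c * c) := by
      rw [hη]
      rfl
    have hc : c ≠ 0 := by
      rintro rfl
      exact hD (by rw [hDeq]; ring)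
    rw [entry, hinv]
    simp [hc, hD]
  · simp only [det_psiMat_swap_wdvvCongruence]
    refine dense_setOf_affine_ne_zero fun linear => ?_
    obtain rfl : d = 0 := by simpa [hinv] using congrFun linear 1
    obtain rfl : e = 0 := by simpa [hinv] using congrFun linear 2
    have entry : η 2 2 = D⁻¹ * (a * 0 - b * b) := by
      rw [hη]
      rfl
    have hb : b ≠ 0 := by
      rintro rfl
      exact hD (by rw [hDeq]; ring)
    rw [entry, hinv]
    simp [hb, hD]

end Nondegeneracy

section Associativity

variable {η : Matrix (Fin 3) (Fin 3) ℝ}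

/-- For `A = (F_{αβν})_{βν}` and `B = (F_{γβν})_{βν}`, the commutator of the multiplications by
`∂_α` and `∂_γ` in the algebra with structure constants `F^λ_{αβ} = η^{λμ} F_{μαβ}`, with an index
lowered by `η`. -/
def mulCommutator {ι : Type*} [Fintype ι] [DecidableEq ι] (η A B : Matrix ι ι ℝ) : Matrix ι ι ℝ :=
  A * η⁻¹ * B - B * η⁻¹ * A

lemma mulCommutator_swap {ι : Type*} [Fintype ι] [DecidableEq ι] (η A B : Matrix ι ι ℝ) :
    mulCommutator η A B = -mulCommutator η B A :=
  (neg_sub _ _).symm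

lemma mulCommutator_self_left {ι : Type*} [Fintype ι] [DecidableEq ι] {η : Matrix ι ι ℝ}
    (hdet : η.det ≠ 0) (B : Matrix ι ι ℝ) : mulCommutator η η B = 0 := by
  rw [mulCommutator, Matrix.mul_nonsing_inv _ hdet.isUnit, Matrix.one_mul, Matrix.mul_assoc,
    Matrix.nonsing_inv_mul _ hdet.isUnit, Matrix.mul_one, sub_self]

lemma mulCommutator_transpose {ι : Type*} [Fintype ι] [DecidableEq ι] {η A B : Matrix ι ι ℝ}
    (hη : η.IsSymm) (hA : A.IsSymm) (hB : B.IsSymm) :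
    (mulCommutator η A B)ᵀ = -mulCommutator η A B := by
  simp only [mulCommutator, Matrix.transpose_sub, Matrix.transpose_mul, hA.eq, hB.eq,
    hη.inv.eq, neg_sub, Matrix.mul_assoc]

lemma mulCommutator_zero_apply {A B : Matrix (Fin 3) (Fin 3) ℝ} (hdet : η.det ≠ 0) {i j : Fin 3}
    (hA : A 0 = η i) (hB : B 0 = η j) (ν : Fin 3) : mulCommutator η A B 0 ν = B i ν - A j ν := by
  have row : ∀ {X Y : Matrix (Fin 3) (Fin 3) ℝ} {k : Fin 3}, X 0 = η k →
      (X * η⁻¹ * Y) 0 = Y k := fun {X Y k} h => by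
    rw [Matrix.mul_assoc, Matrix.mul_apply_eq_vecMul, h, ← Matrix.mul_apply_eq_vecMul,
      Matrix.mul_nonsing_inv_cancel_left _ _ hdet.isUnit]
  rw [mulCommutator, Matrix.sub_apply, row hA, row hB]

lemma eq_zero_iff_of_skew {K : Matrix (Fin 3) (Fin 3) ℝ} (skew : Kᵀ = -K)
    (first_row : ∀ ν, K 0 ν = 0) : K = 0 ↔ K 1 2 = 0 := by
  refine ⟨fun h => by rw [h, Matrix.zero_apply], fun h => ?_⟩
  have anti : ∀ i j, K j i = -K i j := fun i j => congrFun (congrFun skew i) j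
  have diag : ∀ i, K i i = 0 := fun i => self_eq_neg.1 (anti i i)
  ext i j
  fin_cases i <;> fin_cases j <;>
    simp [first_row, diag, anti 0 1, anti 0 2, anti 1 2, h]

end Associativity

section Tensor

variable {η : Matrix (Fin 3) (Fin 3) ℝ} {T : Fin 3 → Fin 3 → Fin 3 → ℝ}

lemma sum_eq_mulCommutator (hη : η.IsSymm) (h12 : ∀ a b c, T a b c = T b a c)
    (h23 : ∀ a b c, T a b c = T a c b) (α β γ ν : Fin 3) :
    ∑ l, ∑ m, η⁻¹ l m * (T l α β * T m γ ν - T l α ν * T m γ β) =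
      mulCommutator η (.of (T α)) (.of (T γ)) β ν := by
  have left : ∀ a b l, T l a b = T a b l := fun a b l => by rw [h12, h23]
  simp only [mulCommutator, Matrix.sub_apply, Matrix.mul_apply, Matrix.of_apply, mul_sub,
    Finset.sum_sub_distrib, Finset.sum_mul]
  congr 1
  · rw [Finset.sum_comm]
    exact Finset.sum_congr rfl fun m _ => Finset.sum_congr rfl fun l _ => by
      rw [left, h12 m]
      ring
  · exact Finset.sum_congr rfl fun l _ => Finset.sum_congr rfl fun m _ => by
      rw [left γ, h12 l, hη.inv.apply]
      ring

lemma forall_sum_eq_zero_iff (hη : η.IsSymm) (hdet : η.det ≠ 0) (h12 : ∀ a b c, T a b c = T b a c)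
    (h23 : ∀ a b c, T a b c = T a c b) (h0 : ∀ a b, T 0 a b = η a b) :
    (∀ α β γ ν, ∑ l, ∑ m, η⁻¹ l m * (T l α β * T m γ ν - T l α ν * T m γ β) = 0) ↔
      mulCommutator η (.of (T 1)) (.of (T 2)) 1 2 = 0 := by
  have symm : ∀ a, (Matrix.of (T a)).IsSymm := fun a => by ext b c; exact h23 a c b
  have row : ∀ a, Matrix.of (T a) 0 = η a := fun a => funext fun c => (h12 a 0 c).trans (h0 a c)
  have unit : Matrix.of (T 0) = η := by ext a b; exact h0 a b
  simp only [sum_eq_mulCommutator hη h12 h23]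
  rw [← eq_zero_iff_of_skew (mulCommutator_transpose hη (symm 1) (symm 2)) fun ν => by
    rw [mulCommutator_zero_apply hdet (row 1) (row 2)]
    exact sub_eq_zero.2 (h12 2 1 ν)]
  refine ⟨fun h => by ext β ν; exact h 1 β 2 ν, fun h α β γ ν => ?_⟩
  suffices mulCommutator η (.of (T α)) (.of (T γ)) = 0 by rw [this, Matrix.zero_apply]
  have self : ∀ A, mulCommutator η A A = 0 := fun A => sub_self _
  have unit_left : ∀ B, mulCommutator η (.of (T 0)) B = 0 := fun B => by
    rw [unit, mulCommutator_self_left hdet]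
  have unit_right : ∀ B, mulCommutator η B (.of (T 0)) = 0 := fun B => by
    rw [mulCommutator_swap, unit_left, neg_zero]
  have h' : mulCommutator η (.of (T 2)) (.of (T 1)) = 0 := by rw [mulCommutator_swap, h, neg_zero]
  fin_cases α <;> fin_cases γ <;> first
    | exact unit_left _ | exact unit_right _ | exact self _ | exact h | exact h'

lemma wdvvCongruence_holds_iff {u v : Fin 3 → ℝ} : (wdvvCongruence η).Holds u v ↔
    v 0 = u 1 ∧ v 1 = u 2 ∧
      η⁻¹ 0 0 * (η 1 1 * η 2 2 - η 1 2 ^ 2) +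
      η⁻¹ 0 1 * (η 1 1 * v 1 - η 1 2 * v 0 - η 1 2 * u 1 + η 2 2 * u 0) +
      η⁻¹ 0 2 * (η 1 1 * v 2 - η 1 2 * v 1 - η 1 2 * u 2 + η 2 2 * u 1) +
      η⁻¹ 1 1 * (u 0 * v 1 - u 1 * v 0) + η⁻¹ 1 2 * (u 0 * v 2 - u 2 * v 0) +
      η⁻¹ 2 2 * (u 1 * v 2 - u 2 * v 1) = 0 := by
  simp only [LineCongruence.Holds, Fin.forall_fin_succ, Fin.sum_univ_three, wdvvCongruence,
    Matrix.of_apply, Matrix.cons_val, Matrix.zero_apply, IsEmpty.forall_iff, and_true,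
    Fin.succ_zero_eq_one, Fin.succ_one_eq_two]
  refine and_congr ?_ (and_congr ?_ ?_) <;> constructor <;> intro h <;> linear_combination h

lemma forall_sum_eq_zero_iff_holds (hη : η.IsSymm) (hdet : η.det ≠ 0)
    (h12 : ∀ a b c, T a b c = T b a c)
    (h23 : ∀ a b c, T a b c = T a c b) (h0 : ∀ a b, T 0 a b = η a b) :
    (∀ α β γ ν, ∑ l, ∑ m, η⁻¹ l m * (T l α β * T m γ ν - T l α ν * T m γ β) = 0) ↔
      (wdvvCongruence η).Holds ![T 1 1 1, T 1 1 2, T 1 2 2] ![T 2 1 1, T 2 1 2, T 2 2 2] := by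
  have right : ∀ a b, T a b 0 = η a b := fun a b => by rw [h23, h12, h0]
  have mid : ∀ a b, T a 0 b = η a b := fun a b => by rw [h12, h0]
  have e112 : T 2 1 1 = T 1 1 2 := by rw [h12, h23]
  have e122 : T 2 1 2 = T 1 2 2 := h12 _ _ _
  have hs : ∀ i j, η⁻¹ i j = η⁻¹ j i := fun i j => hη.inv.apply j i
  rw [forall_sum_eq_zero_iff hη hdet h12 h23 h0, wdvvCongruence_holds_iff]
  simp only [mulCommutator, Matrix.sub_apply, Matrix.mul_apply, Matrix.of_apply,
    Fin.sum_univ_three, Matrix.cons_val, right, mid, e112, e122,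
    hs 1 0, hs 2 0, hs 2 1, hη.apply 1 2, true_and]
  constructor <;> intro h <;> linear_combination h

end Tensor

section PartialDerivatives

variable {W : Set (Fin 3 → ℝ)} {G G' : (Fin 3 → ℝ) → ℝ}

lemma contDiffOn_pderiv (hW : IsOpen W) {k l : WithTop ℕ∞} (hG : ContDiffOn ℝ l G W)
    (hk : k + 1 ≤ l) (a : Fin 3) : ContDiffOn ℝ k (pderiv a G) W :=
  (hG.fderiv_of_isOpen hW hk).clm_apply contDiffOn_const

lemma pderiv_const (a : Fin 3) (r : ℝ) (t : Fin 3 → ℝ) : pderiv a (fun _ => r) t = 0 := by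
  rw [pderiv, fderiv_fun_const, Pi.zero_apply, zero_apply]

lemma pderiv_congr (hW : IsOpen W) (h : ∀ t ∈ W, G t = G' t) (a : Fin 3) {t : Fin 3 → ℝ}
    (ht : t ∈ W) : pderiv a G t = pderiv a G' t := by
  have near : G =ᶠ[nhds t] G' := Filter.eventually_of_mem (hW.mem_nhds ht) h
  rw [pderiv, pderiv, near.fderiv_eq]

lemma pderiv_comm (hW : IsOpen W) (hG : ContDiffOn ℝ 2 G W) (a b : Fin 3) {t : Fin 3 → ℝ}
    (ht : t ∈ W) : pderiv a (pderiv b G) t = pderiv b (pderiv a G) t := by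
  have hd : DifferentiableAt ℝ (fderiv ℝ G) t :=
    ((hG.fderiv_of_isOpen hW (m := 1) one_add_one_eq_two.le).contDiffAt
      (hW.mem_nhds ht)).differentiableAt one_ne_zero
  have second : ∀ c d : Fin 3, pderiv c (pderiv d G) t =
      fderiv ℝ (fderiv ℝ G) t (Pi.single c 1) (Pi.single d 1) := fun c d => by
    change fderiv ℝ (fun s => fderiv ℝ G s (Pi.single d 1)) t _ = _
    rw [fderiv_clm_apply hd (differentiableAt_const _)]
    simp
  rw [second, second]
  exact (hG.contDiffAt (hW.mem_nhds ht)).isSymmSndFDerivAt (by simp) _ _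

lemma fderiv_apply_eq_sum_pderiv (G : (Fin 3 → ℝ) → ℝ) (t x : Fin 3 → ℝ) :
    fderiv ℝ G t x = ∑ a, x a * pderiv a G t := by
  conv_lhs => rw [← Finset.univ_sum_single x, map_sum]
  refine Finset.sum_congr rfl fun a _ => ?_
  rw [pderiv, ← smul_eq_mul, ← map_smul, ← Pi.single_smul, smul_eq_mul, mul_one]

lemma fderiv_sum_smul_proj {ω : Fin 3 → (Fin 3 → ℝ) → ℝ} {t : Fin 3 → ℝ}
    (hω : ∀ a, DifferentiableAt ℝ (ω a) t) (x y : Fin 3 → ℝ) :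
    fderiv ℝ (fun s => ∑ a, ω a s • ContinuousLinearMap.proj (R := ℝ) (φ := fun _ => ℝ) a) t x y =
      ∑ a, ∑ b, x b * y a * pderiv b (ω a) t := by
  have sum_deriv := HasFDerivAt.fun_sum (u := Finset.univ) fun a _ =>
    (hω a).hasFDerivAt.smul_const (ContinuousLinearMap.proj (R := ℝ) (φ := fun _ : Fin 3 => ℝ) a)
  rw [sum_deriv.fderiv]
  simp only [_root_.sum_apply, ContinuousLinearMap.smulRight_apply, _root_.smul_apply,
    ContinuousLinearMap.proj_apply, smul_eq_mul, fderiv_apply_eq_sum_pderiv, Finset.sum_mul]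
  exact Finset.sum_congr rfl fun a _ => Finset.sum_congr rfl fun b _ => by ring

lemma exists_pderiv_eq (hW : IsOpen W) (hconv : Convex ℝ W) {k : ℕ} (hk : k ≠ 0)
    {ω : Fin 3 → (Fin 3 → ℝ) → ℝ} (hω : ∀ a, ContDiffOn ℝ k (ω a) W)
    (hclosed : ∀ t ∈ W, ∀ a b, pderiv a (ω b) t = pderiv b (ω a) t) :
    ∃ f, ContDiffOn ℝ (k + 1 : ℕ) f W ∧ ∀ t ∈ W, ∀ a, pderiv a f t = ω a t := by
  set form : (Fin 3 → ℝ) → ((Fin 3 → ℝ) →L[ℝ] ℝ) := fun t =>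
    ∑ a, ω a t • ContinuousLinearMap.proj (R := ℝ) (φ := fun _ => ℝ) a with hform
  have hk' : (k : WithTop ℕ∞) ≠ 0 := by exact_mod_cast hk
  have smooth : ContDiffOn ℝ k form W := ContDiffOn.sum fun a _ => (hω a).smul contDiffOn_const
  have symm : ∀ t ∈ W, ∀ x y, fderiv ℝ form t x y = fderiv ℝ form t y x := fun t ht x y => by
    have hd : ∀ a, DifferentiableAt ℝ (ω a) t := fun a =>
      ((hω a).contDiffAt (hW.mem_nhds ht)).differentiableAt hk'
    rw [hform, fderiv_sum_smul_proj hd, fderiv_sum_smul_proj hd, Finset.sum_comm]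
    refine Finset.sum_congr rfl fun a _ => Finset.sum_congr rfl fun b _ => ?_
    rw [hclosed t ht a b, mul_comm (x a)]
  obtain ⟨f, hf⟩ := hconv.exists_forall_hasFDerivAt_of_fderiv_symmetric hW
    (smooth.differentiableOn hk') symm
  refine ⟨f, ?_, fun t ht a => ?_⟩
  · rw [Nat.cast_add, Nat.cast_one, contDiffOn_succ_iff_fderiv_of_isOpen hW]
    exact ⟨fun t ht => (hf t ht).differentiableAt.differentiableWithinAt, by simp,
      smooth.congr fun t ht => (hf t ht).fderiv⟩
  · rw [pderiv, (hf t ht).fderiv, hform]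
    simp [Pi.single_apply]

lemma exists_third_eq (hW : IsOpen W) (hconv : Convex ℝ W)
    {T : Fin 3 → Fin 3 → Fin 3 → (Fin 3 → ℝ) → ℝ} (hT : ∀ a b c, ContDiffOn ℝ 1 (T a b c) W)
    (h12 : ∀ t ∈ W, ∀ a b c, T a b c t = T b a c t)
    (h23 : ∀ t ∈ W, ∀ a b c, T a b c t = T a c b t)
    (hclosed : ∀ t ∈ W, ∀ d a b c, pderiv d (T a b c) t = pderiv a (T d b c) t) :
    ∃ F, ContDiffOn ℝ 4 F W ∧ ∀ t ∈ W, ∀ a b c, third F a b c t = T a b c t := by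
  choose G hG hGT using fun b c => exists_pderiv_eq hW hconv (k := 1) one_ne_zero
    (ω := fun a => T a b c) (fun a => by simpa using hT a b c)
    (fun t ht a d => hclosed t ht a d b c)
  -- `G b c` and `G c b` may differ by a constant, so one of the two is chosen for both.
  set K : Fin 3 → Fin 3 → (Fin 3 → ℝ) → ℝ := fun b c => G (min b c) (max b c) with hK
  have hKT : ∀ b c, ∀ t ∈ W, ∀ a, pderiv a (K b c) t = T a b c t := fun b c t ht a => by
    rw [hK, hGT _ _ t ht]
    rcases le_total b c with h | h
    · rw [min_eq_left h, max_eq_right h]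
    · rw [min_eq_right h, max_eq_left h, h23 t ht]
  choose H hH hHK using fun c => exists_pderiv_eq hW hconv (k := 2) two_ne_zero
    (ω := fun b => K b c) (fun b => hG _ _)
    (fun t ht a b => by rw [hKT b c t ht, hKT a c t ht, h12 t ht])
  obtain ⟨F, hF, hFH⟩ := exists_pderiv_eq hW hconv (k := 3) three_ne_zero (ω := H) hH
    (fun t ht b c => by rw [hHK c t ht, hHK b t ht]; simp only [hK, min_comm, max_comm])
  refine ⟨F, hF, fun t ht a b c => ?_⟩
  have second : ∀ s ∈ W, pderiv b (pderiv c F) s = K b c s := fun s hs => by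
    rw [pderiv_congr hW (fun r hr => hFH r hr c) b hs, hHK c s hs]
  rw [third, pderiv_congr hW second a ht, hKT b c t ht]

variable {F : (Fin 3 → ℝ) → ℝ}

lemma contDiffOn_pderiv_pderiv (hW : IsOpen W) (hF : ContDiffOn ℝ 4 F W) (b c : Fin 3) :
    ContDiffOn ℝ 2 (pderiv b (pderiv c F)) W :=
  contDiffOn_pderiv hW (contDiffOn_pderiv (k := 3) hW hF (by norm_num) c) (by norm_num) b

lemma third_swap_left (hW : IsOpen W) (hF : ContDiffOn ℝ 4 F W) {t : Fin 3 → ℝ} (ht : t ∈ W)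
    (a b c : Fin 3) : third F a b c t = third F b a c t :=
  pderiv_comm hW (contDiffOn_pderiv hW hF (by norm_num) c) a b ht

lemma third_swap_right (hW : IsOpen W) (hF : ContDiffOn ℝ 4 F W) {t : Fin 3 → ℝ} (ht : t ∈ W)
    (a b c : Fin 3) : third F a b c t = third F a c b t :=
  pderiv_congr hW (fun _ hs => pderiv_comm hW (hF.of_le (by norm_num)) b c hs) a ht

lemma contDiffOn_fields (hW : IsOpen W) (hF : ContDiffOn ℝ 4 F W) (p : Fin 3) :
    ContDiffOn ℝ 1 (fields F p) W := by
  have h : ∀ b c, ContDiffOn ℝ 1 (third F p b c) W := fun b c =>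
    contDiffOn_pderiv hW (contDiffOn_pderiv_pderiv hW hF b c) one_add_one_eq_two.le p
  refine contDiffOn_pi.2 fun I => ?_
  fin_cases I <;> exact h _ _

lemma pderiv_fields_comm (hW : IsOpen W) (hF : ContDiffOn ℝ 4 F W) (p q I : Fin 3)
    {t : Fin 3 → ℝ} (ht : t ∈ W) :
    pderiv q (fun s => fields F p s I) t = pderiv p (fun s => fields F q s I) t := by
  have h : ∀ b c, pderiv q (third F p b c) t = pderiv p (third F q b c) t := fun b c =>
    pderiv_comm hW (contDiffOn_pderiv_pderiv hW hF b c) q p ht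
  fin_cases I <;> exact h _ _

end PartialDerivatives

lemma contDiff_det {ι : Type*} [Fintype ι] [DecidableEq ι] {E : Type*} [NormedAddCommGroup E]
    [NormedSpace ℝ E] {k : WithTop ℕ∞} {M : E → Matrix ι ι ℝ}
    (hM : ∀ i j, ContDiff ℝ k fun x => M x i j) : ContDiff ℝ k fun x => (M x).det := by
  simp only [Matrix.det_apply']
  exact ContDiff.sum fun σ _ => contDiff_const.mul (contDiff_prod fun i _ => hM _ _)

namespace LineCongruence

variable {n : ℕ} (C : LineCongruence n)

lemma contDiffOn_flux {k : WithTop ℕ∞} : ContDiffOn ℝ k C.flux C.regular := by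
  refine contDiffOn_pi.2 fun i => ?_
  have cramer : ∀ u, C.flux u i = (C.psiMat u).det⁻¹ *
      ((C.psiMat u).updateCol i (C.theta *ᵥ u + C.xi)).det := fun u => by
    rw [← Matrix.cramer_apply, Matrix.cramer_eq_adjugate_mulVec, flux, Matrix.inv_def,
      Ring.inverse_eq_inv', Matrix.smul_mulVec, Pi.smul_apply, smul_eq_mul]
  simp only [cramer]
  refine ((contDiff_det C.contDiff_psiMat).contDiffOn.inv fun u hu => hu).mul
    (contDiff_det fun a b => ?_).contDiffOn
  obtain rfl | hb := eq_or_ne b i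
  · simp only [Matrix.updateCol_self, Pi.add_apply, Matrix.mulVec, dotProduct]
    fun_prop
  · simp only [Matrix.updateCol_ne hb]
    exact C.contDiff_psiMat a b

end LineCongruence

section Equivalence

variable {η : Matrix (Fin 3) (Fin 3) ℝ} {W : Set (Fin 3 → ℝ)} {F : (Fin 3 → ℝ) → ℝ}

lemma solvesWDVV_iff_wdvvCongruence (hsymm : η.IsSymm) (hdet : η.det ≠ 0) (hW : IsOpen W)
    (hF : IsNormalized η W F) :
    SolvesWDVV η W F ↔ ∀ t ∈ W, (wdvvCongruence η).Holds (fields F 1 t) (fields F 2 t) :=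
  forall₂_congr fun t ht => forall_sum_eq_zero_iff_holds hsymm hdet
    (T := fun a b c => third F a b c t) (third_swap_left hW hF.1 ht)
    (third_swap_right hW hF.1 ht) (hF.2 t ht)

/-- The symmetric tensor `F_{abc}` of a normalized `F` in terms of `u = (F_{222}, F_{223}, F_{233})`
and `v = (F_{322}, F_{323}, F_{333})`; it is symmetric when `v 0 = u 1` and `v 1 = u 2`. -/
def thirdTensor (η : Matrix (Fin 3) (Fin 3) ℝ) (u v : Fin 3 → ℝ) (a : Fin 3) :
    Matrix (Fin 3) (Fin 3) ℝ :=
  ![η,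
    !![η 1 0, η 1 1, η 1 2; η 1 1, u 0, u 1; η 1 2, u 1, u 2],
    !![η 2 0, η 2 1, η 2 2; η 2 1, v 0, v 1; η 2 2, v 1, v 2]] a

lemma thirdTensor_swap_left (hsymm : η.IsSymm) {u v : Fin 3 → ℝ} (h0 : v 0 = u 1) (h1 : v 1 = u 2)
    (a b c : Fin 3) : thirdTensor η u v a b c = thirdTensor η u v b a c := by
  fin_cases a <;> fin_cases b <;> fin_cases c <;> first
    | rfl | exact hsymm.apply _ _ | exact (hsymm.apply _ _).symm
    | exact h0 | exact h0.symm | exact h1 | exact h1.symm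

lemma thirdTensor_swap_right (hsymm : η.IsSymm) (u v : Fin 3 → ℝ) (a b c : Fin 3) :
    thirdTensor η u v a b c = thirdTensor η u v a c b := by
  fin_cases a <;> fin_cases b <;> fin_cases c <;> first
    | rfl | exact hsymm.apply _ _

lemma contDiffOn_thirdTensor {u v : (Fin 3 → ℝ) → Fin 3 → ℝ} (hu : ContDiffOn ℝ 1 u W)
    (hv : ContDiffOn ℝ 1 v W) (a b c : Fin 3) :
    ContDiffOn ℝ 1 (fun t => thirdTensor η (u t) (v t) a b c) W := by
  fin_cases a <;> fin_cases b <;> fin_cases c <;> first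
    | exact contDiffOn_const | exact contDiffOn_pi.1 hu _ | exact contDiffOn_pi.1 hv _

lemma pderiv_thirdTensor (η : Matrix (Fin 3) (Fin 3) ℝ) (u v : (Fin 3 → ℝ) → Fin 3 → ℝ)
    (t : Fin 3 → ℝ) (d a b c : Fin 3) :
    pderiv d (fun s => thirdTensor η (u s) (v s) a b c) t =
      thirdTensor 0 (fun I => pderiv d (fun s => u s I) t) (fun I => pderiv d (fun s => v s I) t)
        a b c := by
  fin_cases a <;> fin_cases b <;> fin_cases c <;> first | rfl | exact pderiv_const _ _ _

lemma thirdTensor_closed {du dv : Fin 3 → Fin 3 → ℝ} (hu : du 0 = 0) (hv : dv 0 = 0)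
    (h : du 2 = dv 1) (d a b c : Fin 3) :
    thirdTensor 0 (du d) (dv d) a b c = thirdTensor 0 (du a) (dv a) d b c := by
  fin_cases d <;> fin_cases a <;>
    simp only [Fin.mk_one, Fin.reduceFinMk, Fin.zero_eta, hu, hv, h] <;>
    fin_cases b <;> fin_cases c <;> rfl

lemma exists_solution (hsymm : η.IsSymm) (hdet : η.det ≠ 0) (hW : IsOpen W) (hconv : Convex ℝ W)
    {u v : (Fin 3 → ℝ) → Fin 3 → ℝ} (hu : ContDiffOn ℝ 1 u W) (hv : ContDiffOn ℝ 1 v W)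
    (hu0 : ∀ t ∈ W, ∀ I, pderiv 0 (fun s => u s I) t = 0)
    (hv0 : ∀ t ∈ W, ∀ I, pderiv 0 (fun s => v s I) t = 0)
    (hlaw : ∀ t ∈ W, ∀ I, pderiv 2 (fun s => u s I) t = pderiv 1 (fun s => v s I) t)
    (holds : ∀ t ∈ W, (wdvvCongruence η).Holds (u t) (v t)) :
    ∃ F, IsNormalized η W F ∧ SolvesWDVV η W F ∧ (∀ t ∈ W, fields F 1 t = u t) ∧
      ∀ t ∈ W, fields F 2 t = v t := by
  have closed : ∀ t ∈ W, ∀ d a b c,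
      pderiv d (fun s => thirdTensor η (u s) (v s) a b c) t =
        pderiv a (fun s => thirdTensor η (u s) (v s) d b c) t := fun t ht d a b c => by
    simp only [pderiv_thirdTensor]
    exact thirdTensor_closed (du := fun e I => pderiv e (fun s => u s I) t)
      (dv := fun e I => pderiv e (fun s => v s I) t) (funext (hu0 t ht)) (funext (hv0 t ht))
      (funext (hlaw t ht)) d a b c
  have coupled := fun t ht => wdvvCongruence_holds_iff.1 (holds t ht)
  obtain ⟨F, hF, hFT⟩ := exists_third_eq hW hconv (contDiffOn_thirdTensor hu hv)
    (fun t ht => thirdTensor_swap_left hsymm (coupled t ht).1 (coupled t ht).2.1)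
    (fun t _ => thirdTensor_swap_right hsymm (u t) (v t)) closed
  have fields_one : ∀ t ∈ W, fields F 1 t = u t := fun t ht => by
    ext I
    fin_cases I <;> exact hFT t ht _ _ _
  have fields_two : ∀ t ∈ W, fields F 2 t = v t := fun t ht => by
    ext I
    fin_cases I <;> exact hFT t ht _ _ _
  have normalized : IsNormalized η W F := ⟨hF, fun t ht => hFT t ht 0⟩
  refine ⟨F, normalized, ?_, fields_one, fields_two⟩
  exact (solvesWDVV_iff_wdvvCongruence hsymm hdet hW normalized).2 fun t ht => by
    rw [fields_one t ht, fields_two t ht]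
    exact holds t ht

lemma pderiv_comp_eq_zero {n : ℕ} {V : (Fin n → ℝ) → Fin n → ℝ} {u : (Fin 3 → ℝ) → Fin n → ℝ}
    {t : Fin 3 → ℝ} {a : Fin 3} (hV : DifferentiableAt ℝ V (u t)) (hu : DifferentiableAt ℝ u t)
    (hz : ∀ I, pderiv a (fun s => u s I) t = 0) (I : Fin n) :
    pderiv a (fun s => V (u s) I) t = 0 := by
  have zero : fderiv ℝ u t (Pi.single a 1) = 0 := funext fun J => by
    rw [Pi.zero_apply, ← hz J, pderiv, (hasFDerivAt_pi'.1 hu.hasFDerivAt J).fderiv]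
    rfl
  have comp := hasFDerivAt_pi'.1 (hV.hasFDerivAt.comp t hu.hasFDerivAt) I
  rw [pderiv, show (fun s => V (u s) I) = fun s => (V ∘ u) s I from rfl, comp.fderiv]
  simp only [ContinuousLinearMap.comp_apply, zero, map_zero]

variable {p q : Fin 3} (hpq : (p = 1 ∧ q = 2) ∨ (p = 2 ∧ q = 1))
include hpq

lemma solvesWDVV_iff_chosenCongruence (hsymm : η.IsSymm) (hdet : η.det ≠ 0) (hW : IsOpen W)
    (hF : IsNormalized η W F) :
    SolvesWDVV η W F ↔
      ∀ t ∈ W, (chosenCongruence η p).Holds (fields F p t) (fields F q t) := by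
  rw [solvesWDVV_iff_wdvvCongruence hsymm hdet hW hF]
  rcases hpq with ⟨rfl, rfl⟩ | ⟨rfl, rfl⟩
  · rfl
  · exact forall₂_congr fun t _ => LineCongruence.swap_holds_iff.symm

lemma conservationLawAt_fields (hsymm : η.IsSymm) (hdet : η.det ≠ 0) (hW : IsOpen W)
    (hF : IsNormalized η W F) (hS : SolvesWDVV η W F) {t : Fin 3 → ℝ} (ht : t ∈ W)
    (hreg : fields F p t ∈ (chosenCongruence η p).regular) :
    ConservationLawAt p q (chosenCongruence η p).flux (fields F p) t := fun I => by
  have hopen : IsOpen (W ∩ fields F p ⁻¹' (chosenCongruence η p).regular) :=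
    (contDiffOn_fields hW hF.1 p).continuousOn.isOpen_inter_preimage hW
      (LineCongruence.isOpen_regular _)
  have flux_eq : ∀ s ∈ W ∩ fields F p ⁻¹' (chosenCongruence η p).regular,
      (chosenCongruence η p).flux (fields F p s) I = fields F q s I := fun s hs => by
    rw [← (LineCongruence.holds_iff_eq_flux (isMongeSystem_chosenCongruence hsymm hdet p).skew
      hs.2 _).1 ((solvesWDVV_iff_chosenCongruence hpq hsymm hdet hW hF).1 hS s hs.1)]
  rw [pderiv_congr hopen flux_eq p ⟨ht, hreg⟩, pderiv_fields_comm hW hF.1 p q I ht]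

lemma exists_solution_of_conservationLaw (hsymm : η.IsSymm) (hdet : η.det ≠ 0) (hW : IsOpen W)
    (hconv : Convex ℝ W) {u : (Fin 3 → ℝ) → Fin 3 → ℝ} (hu : ContDiffOn ℝ 1 u W)
    (hu0 : ∀ t ∈ W, ∀ I, pderiv 0 (fun s => u s I) t = 0)
    (hreg : ∀ t ∈ W, u t ∈ (chosenCongruence η p).regular)
    (hlaw : ∀ t ∈ W, ConservationLawAt p q (chosenCongruence η p).flux u t) :
    ∃ F, IsNormalized η W F ∧ SolvesWDVV η W F ∧ ∀ t ∈ W, fields F p t = u t := by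
  have smooth := (chosenCongruence η p).contDiffOn_flux (k := 1)
  have hv := smooth.comp hu hreg
  have hv0 : ∀ t ∈ W, ∀ I, pderiv 0 (fun s => (chosenCongruence η p).flux (u s) I) t = 0 :=
    fun t ht => pderiv_comp_eq_zero
      ((smooth.contDiffAt ((LineCongruence.isOpen_regular _).mem_nhds
        (hreg t ht))).differentiableAt one_ne_zero)
      ((hu.contDiffAt (hW.mem_nhds ht)).differentiableAt one_ne_zero) (hu0 t ht)
  have holds : ∀ t ∈ W, (chosenCongruence η p).Holds (u t) ((chosenCongruence η p).flux (u t)) :=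
    fun t ht => (LineCongruence.holds_iff_eq_flux
      (isMongeSystem_chosenCongruence hsymm hdet p).skew (hreg t ht) _).2 rfl
  rcases hpq with ⟨rfl, rfl⟩ | ⟨rfl, rfl⟩
  · obtain ⟨F, hF, hS, fields_one, -⟩ :=
      exists_solution hsymm hdet hW hconv hu hv hu0 hv0 hlaw holds
    exact ⟨F, hF, hS, fields_one⟩
  · obtain ⟨F, hF, hS, -, fields_two⟩ :=
      exists_solution hsymm hdet hW hconv hv hu hv0 hu0 (fun t ht I => (hlaw t ht I).symm)
        fun t ht => LineCongruence.swap_holds_iff.1 (holds t ht)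
    exact ⟨F, hF, hS, fields_two⟩

end Equivalence

end WDVV

end

theorem mainTheorem9 (η : Matrix (Fin 3) (Fin 3) ℝ) (hsymm : η.IsSymm) (hdet : η.det ≠ 0)
    (p q : Fin 3) (hpq : (p = 1 ∧ q = 2) ∨ (p = 2 ∧ q = 1)) :
    -- `φ` and `ψ` are nondegenerate
    (WDVV.phi η).det ≠ 0 ∧
    IsOpen (WDVV.chosenCongruence η p).regular ∧
    Dense (WDVV.chosenCongruence η p).regular ∧
    -- the WDVV system is the linear line congruence
    (∀ (W : Set (Fin 3 → ℝ)) (F : (Fin 3 → ℝ) → ℝ), IsOpen W → WDVV.IsNormalized η W F →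
      (WDVV.SolvesWDVV η W F ↔ ∀ t ∈ W,
        (WDVV.chosenCongruence η p).Holds (WDVV.fields F p t) (WDVV.fields F q t))) ∧
    -- the congruence can be solved for the fluxes
    (∀ u ∈ (WDVV.chosenCongruence η p).regular, ∀ v : Fin 3 → ℝ,
      (WDVV.chosenCongruence η p).Holds u v ↔ v = (WDVV.chosenCongruence η p).flux u) ∧
    -- solutions of the WDVV system give solutions of the system of conservation laws
    (∀ (W : Set (Fin 3 → ℝ)) (F : (Fin 3 → ℝ) → ℝ), IsOpen W → WDVV.IsNormalized η W F →
      WDVV.SolvesWDVV η W F →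
      ∀ t ∈ W, WDVV.fields F p t ∈ (WDVV.chosenCongruence η p).regular →
        WDVV.ConservationLawAt p q (WDVV.chosenCongruence η p).flux (WDVV.fields F p) t) ∧
    -- and conversely
    (∀ (W : Set (Fin 3 → ℝ)) (u : (Fin 3 → ℝ) → Fin 3 → ℝ), IsOpen W → Convex ℝ W →
      ContDiffOn ℝ 1 u W → (∀ t ∈ W, ∀ I, WDVV.pderiv 0 (fun s => u s I) t = 0) →
      (∀ t ∈ W, u t ∈ (WDVV.chosenCongruence η p).regular) →
      (∀ t ∈ W, WDVV.ConservationLawAt p q (WDVV.chosenCongruence η p).flux u t) →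
      ∃ F : (Fin 3 → ℝ) → ℝ, WDVV.IsNormalized η W F ∧ WDVV.SolvesWDVV η W F ∧
        ∀ t ∈ W, WDVV.fields F p t = u t) ∧
    -- the Monge metric defines a third-order Hamiltonian operator
    WDVV.IsThirdOrderHamiltonian (WDVV.chosenCongruence η p).regular
      ((WDVV.chosenCongruence η p).monge (WDVV.phi η)) ∧
    -- with respect to which the system of conservation laws is Hamiltonian
    WDVV.IsHamiltonianSystem (WDVV.chosenCongruence η p).regular
      ((WDVV.chosenCongruence η p).monge (WDVV.phi η)) (WDVV.chosenCongruence η p).flux := by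
  have hC := WDVV.isMongeSystem_chosenCongruence hsymm hdet p
  exact ⟨WDVV.det_phi_ne_zero hsymm hdet,
    WDVV.LineCongruence.isOpen_regular _,
    WDVV.dense_regular_chosenCongruence hsymm hdet p,
    fun _ _ hW hF => WDVV.solvesWDVV_iff_chosenCongruence hpq hsymm hdet hW hF,
    fun _ hu v => WDVV.LineCongruence.holds_iff_eq_flux hC.skew hu v,
    fun _ _ hW hF hS _ ht hreg => WDVV.conservationLawAt_fields hpq hsymm hdet hW hF hS ht hreg,
    fun _ _ hW hconv hu hu0 hreg hlaw =>
      WDVV.exists_solution_of_conservationLaw hpq hsymm hdet hW hconv hu hu0 hreg hlaw,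
    hC.toIsMonge.isThirdOrderHamiltonian,
    hC.isHamiltonianSystem⟩
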